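/- For integers $k,l\ge 2$ and $n\ge 0$ let $t_k(G)$ be the number of copies of $K_k$ in a graph $G$, and let $f(n,k,l)$ be the minimum of $t_k(G)$ over all (finite, simple) graphs $G$ on $n$ vertices with independence number $\alpha(G)<l$. Let $\overline{T_{n,3}}$ be the complement of the Turán graph $T_{n,3}$, that is, the disjoint union of three cliques on $n$ vertices in total whose sizes differ pairwise by at most $1$. Call a graph $G$ on $n$ vertices extremal if $\alpha(G)\le 3$ and $t_3(G)=f(n,3,4)$. Theorem. There is $n_0$ such that for every $n\ge n_0$: 1. $f(n,3,4)=\binom{\lfloor n/3\rfloor}{3}+\binom{\lfloor (n+1)/3\rfloor}{3}+\binom{\lfloor (n+2)/3\rfloor}{3}$. 2. The graph $\overline{T_{n,3}}$ is extremal (Erdős' conjecture for $(k,l)=(3,4)$). 3. Every extremal graph on $n$ vertices contains $\overline{T_{n,3}}$ as a (spanning) subgraph. More precisely, a graph $G$ on $n$ vertices is extremal if and only if its vertex set can be partitioned into three cliques $C_1,C_2,C_3$ of $G$, whose sizes differ pairwise by at most $1$, such that for all $i\ne j$ the edges of $G$ between $C_i$ and $C_j$ form a (possibly empty) matching, and $G$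 has no triangle with one vertex in each of $C_1,C_2,C_3$. Moreover, $f(n,3,4)\sim\frac19\binom n3$ as $n\to\infty$. -/

import Mathlib

namespace SimpleGraph

/-- `t_k(G)`: the number of copies of `K_k` in `G`, counted as `k`-element vertex sets that
are cliques. -/
noncomputable def numCliques {V : Type*} (G : SimpleGraph V) (k : ℕ) : ℕ :=
  (G.cliqueSet k).ncard

/-- `f(n,k,l)`: the minimum of `t_k(G)` over all graphs `G` on `n` vertices that have no
independent set of size `l`. See `isLeast_minCliques` for the fact that it is a minimum. -/
noncomputable def minCliques (n k l : ℕ) : ℕ :=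
  sInf {m : ℕ | ∃ G : SimpleGraph (Fin n), G.IndepSetFree l ∧ G.numCliques k = m}

theorem isLeast_minCliques (n k l : ℕ) (hl : 2 ≤ l) :
    IsLeast {m : ℕ | ∃ G : SimpleGraph (Fin n), G.IndepSetFree l ∧ G.numCliques k = m}
      (minCliques n k l) := by
  refine ⟨Nat.sInf_mem ⟨_, ⊤, ?_, rfl⟩, fun m hm => Nat.sInf_le hm⟩
  rw [← cliqueFree_compl, compl_top]
  exact cliqueFree_bot hl

/-- `G` is extremal for the `(k,l)`-problem: it has no independent set of size `l`, and it has
the least possible number of copies of `K_k` for its number of vertices. -/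
def IsCliqueExtremal {V : Type*} [Fintype V] (G : SimpleGraph V) (k l : ℕ) : Prop :=
  G.IndepSetFree l ∧ G.numCliques k = minCliques (Fintype.card V) k l

/-- The sets `C 0`, `C 1`, `C 2` partition the vertices of `G` into three cliques with sizes as
equal as possible, the edges of `G` between any two of them form a (partial) matching, and no
triangle of `G` has one vertex in each of them. -/
structure IsCliqueMatchingPartition {V : Type*} (G : SimpleGraph V) (C : Fin 3 → Finset V) :
    Prop where
  disjoint : ∀ i j, i ≠ j → Disjoint (C i) (C j)
  cover : ∀ v, ∃ i, v ∈ C i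
  isClique : ∀ i, G.IsClique (C i : Set V)
  card_le : ∀ i j, (C i).card ≤ (C j).card + 1
  matching : ∀ i j, i ≠ j → ∀ v ∈ C i, ∀ w ∈ C j, ∀ w' ∈ C j,
    G.Adj v w → G.Adj v w' → w = w'
  no_transversal : ∀ x ∈ C 0, ∀ y ∈ C 1, ∀ z ∈ C 2,
    ¬ (G.Adj x y ∧ G.Adj y z ∧ G.Adj x z)

end SimpleGraph

/-! Three disjoint balanced cliques give the upper bound. The main task is to show that a large
minimiser `G` is covered by three cliques. Convexity of `a ↦ a.choose 3` then forces balanced sizes,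
and equality forces every triangle into one of the cliques, which is the matching condition together
with the absence of transversal triangles.

All counts use the relation "equal or adjacent", with repetitions allowed, so that sums over tuples
of vertices are exact and carry no lower-order error. Write d(v) and t(v) for `closedDeg` and
`closedTri`, and n for the number of vertices. A flag algebra certificate
(`FlagCertificate.sum_sq_le`) gives 2n Σ (n - 3d(v))² ≤ Σ (9t(v) - n²)(13n - 12d(v)). In a
minimiser, replacing a vertex by a clone of another creates no independent 4-set, so the numbers
t(v) agree up to O(n) (`closedTri_le_of_forall_numCliques_le`). Their mean is at most n²/9 + O(n) by
the upper bound, and the weights 13n - 12d(v) are positive, so every t(v) is n²/9 + O(n) and Σ (n -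
3d(v))² = O(n²) (`IndepSetFree.bounds`).

Hence all but a few vertices have degree near n/3, and their closed neighbourhoods are nearly
cliques. Three pairwise nonadjacent vertices of this kind yield three near-cliques that cover
everything (`exists_partition_of_typical`). Forbidding independent 4-sets turns these into an exact
cover by cliques (`exists_partition_of_near_cliques`). -/

namespace SimpleGraph

/-! ### The flag algebra inequality. -/

namespace FlagCertificate

/-- The quadratic form for the type of an edge `uv` and an isolated vertex `w`. -/
def edgeForm (F₁ F₂ F₃ F₄ O₁ O₂ F₁' F₂' F₃' F₄' O₁' O₂' : ℤ) : ℤ :=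
  F₁ * (176 * F₁' + 114 * F₂' - 90 * F₃' + 95 * F₄')
    + F₂ * (114 * F₁' + 90 * F₂' - 72 * F₃' + 72 * F₄')
    + F₃ * (-90 * F₁' - 72 * F₂' + 72 * F₃' - 72 * F₄')
    + F₄ * (95 * F₁' + 72 * F₂' - 72 * F₃' + 80 * F₄')
    + O₁ * (108 * O₁' - 54 * O₂') + O₂ * (-54 * O₁' + 252 * O₂')

/-- The quadratic form for the type of a path with centre `w` and ends `u`, `v`. -/
def pathForm (E₁ E₂ E₃ E₄ E₅ E₁' E₂' E₃' E₄' E₅' : ℤ) : ℤ :=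
  E₁ * (504 * E₁' - 180 * E₂' + 36 * E₃' + 180 * E₄' + 396 * E₅')
    + E₂ * (-180 * E₁' + 90 * E₂' - 36 * E₃' - 36 * E₄' - 126 * E₅')
    + E₃ * (36 * E₁' - 36 * E₂' + 108 * E₃' - 72 * E₄' - 36 * E₅')
    + E₄ * (180 * E₁' - 36 * E₂' - 72 * E₃' + 138 * E₄' + 193 * E₅')
    + E₅ * (396 * E₁' - 126 * E₂' - 36 * E₃' + 193 * E₄' + 364 * E₅')

/-- The indicator of the flag `(p, q, r)`. -/
def flag (p q r a b c : Bool) : ℤ := if (p == a && q == b && r == c) then 1 else 0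

/-! `f₁`, …, `f₄` and `o₁`, `o₂` are combinations of flags over the edge type that are symmetric
and antisymmetric in `u`, `v`; `e₁`, …, `e₅` are symmetric combinations over the path type. -/

def f₁ (a b c : Bool) : ℤ := flag false false false a b c - flag true true false a b c
def f₂ (a b c : Bool) : ℤ := flag true true true a b c
def f₃ (a b c : Bool) : ℤ := flag true false true a b c + flag false true true a b c
def f₄ (a b c : Bool) : ℤ := flag true false false a b c + flag false true false a b c
  - 2 * flag false false true a b c + 2 * flag true true false a b c
def o₁ (a b c : Bool) : ℤ := flag true false false a b c - flag false true false a b c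
def o₂ (a b c : Bool) : ℤ := flag true false true a b c - flag false true true a b c
def e₁ (a b c : Bool) : ℤ := flag false false true a b c
def e₂ (a b c : Bool) : ℤ := flag true true false a b c
def e₃ (a b c : Bool) : ℤ := flag true true true a b c
def e₄ (a b c : Bool) : ℤ := flag true false false a b c + flag false true false a b c
  - flag true false true a b c - flag false true true a b c
def e₅ (a b c : Bool) : ℤ := flag false false false a b c - flag true false false a b c
  - flag false true false a b c

def edgeTerm (a b c a' b' c' : Bool) : ℤ :=
  edgeForm (f₁ a b c) (f₂ a b c) (f₃ a b c) (f₄ a b c) (o₁ a b c) (o₂ a b c)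
    (f₁ a' b' c') (f₂ a' b' c') (f₃ a' b' c') (f₄ a' b' c') (o₁ a' b' c') (o₂ a' b' c')

def pathTerm (a b c a' b' c' : Bool) : ℤ :=
  pathForm (e₁ a b c) (e₂ a b c) (e₃ a b c) (e₄ a b c) (e₅ a b c)
    (e₁ a' b' c') (e₂ a' b' c') (e₃ a' b' c') (e₄ a' b' c') (e₅ a' b' c')

/-- The square contributed by a triple `u, v, w`, as a function of the adjacencies
`uv`, `uw`, `vw` and of those of two further vertices to `u`, `v`, `w`. -/
def tripleTerm (uv uw vw a b c a' b' c' : Bool) : ℤ :=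
  match uv, uw, vw with
  | true, false, false => edgeTerm a b c a' b' c'
  | false, true, false => edgeTerm a c b a' c' b'
  | false, false, true => edgeTerm b c a b' c' a'
  | false, true, true => pathTerm a b c a' b' c'
  | true, false, true => pathTerm a c b a' c' b'
  | true, true, false => pathTerm b c a b' c' a'
  | _, _, _ => 0

/-- The density of closed triangles at a root `v`, centred and weighted by a non-degree, minus the
square of the centred degree; `ab` and the others are adjacencies to the root or among pairs. -/
def rootTerm (va vb vc vd ab : Bool) : ℤ :=
  (9 * (va && vb && ab).toNat - 1) * (26 - 12 * vc.toNat - 12 * vd.toNat)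
    - 4 * (1 - 3 * va.toNat) * (1 - 3 * vb.toNat)

/-- The sum of `rootTerm` over the pairs among four vertices `a`, `b`, `c`, `d`. -/
def rootSum (va vb vc vd ab ac ad bc bd cd : Bool) : ℤ :=
  rootTerm va vb vc vd ab + rootTerm va vc vb vd ac + rootTerm va vd vb vc ad
    + rootTerm vb vc va vd bc + rootTerm vb vd va vc bd + rootTerm vc vd va vb cd

/-- The certificate on all patterns of five vertices `0`, …, `4` without four pairwise nonadjacent
ones; the variables are the adjacencies `01`, `02`, `03`, `04`, `12`, `13`, `14`, `23`, `24`, `34`. -/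
theorem pointwise : ∀ a b c d e f g h i j : Bool,
    (a || b || c || e || f || h) && (a || b || d || e || g || i) && (a || c || d || f || g || j)
      && (b || c || d || h || i || j) && (e || f || g || h || i || j) →
    3 * (tripleTerm a b e c f h d g i + tripleTerm a c f b e h d g j
      + tripleTerm a d g b e i c f j + tripleTerm b c h a e f d i j
      + tripleTerm b d i a e g c h j + tripleTerm c d j a f g b h i
      + tripleTerm e f h a b c g i j + tripleTerm e g i a b d f h j
      + tripleTerm f g j a c d e h i + tripleTerm h i j b c d e f g) ≤
    2 * (rootSum a b c d e f g h i j + rootSum a e f g b c d h i j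
      + rootSum b e h i a c d f g j + rootSum c f h j a b d e g i
      + rootSum d g i j a b c e f h) := by
  -- There are only 2 ^ 10 adjacency patterns, so the kernel checks them all.
  decide +kernel

/-- The form splits into a part in the `F`s and a part in the `O`s; the squares come from completing
the square one variable at a time. -/
theorem edgeForm_self_nonneg (F₁ F₂ F₃ F₄ O₁ O₂ : ℤ) :
    0 ≤ edgeForm F₁ F₂ F₃ F₄ O₁ O₂ F₁ F₂ F₃ F₄ O₁ O₂ := by
  unfold edgeForm
  nlinarith [sq_nonneg (176 * F₁ + 114 * F₂ - 90 * F₃ + 95 * F₄),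
    sq_nonneg (474 * F₂ - 402 * F₃ + 307 * F₄), sq_nonneg (378 * F₃ - 383 * F₄),
    sq_nonneg F₄, sq_nonneg (2 * O₁ - O₂), sq_nonneg O₂]

theorem pathForm_self_nonneg (E₁ E₂ E₃ E₄ E₅ : ℤ) :
    0 ≤ pathForm E₁ E₂ E₃ E₄ E₅ E₁ E₂ E₃ E₄ E₅ := by
  unfold pathForm
  nlinarith [sq_nonneg (14 * E₁ - 5 * E₂ + E₃ + 5 * E₄ + 11 * E₅),
    sq_nonneg (10 * E₂ - 9 * E₃ + 11 * E₄ + 6 * E₅), sq_nonneg (47 * E₃ - 33 * E₄ - 28 * E₅),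
    sq_nonneg (42 * E₄ - 37 * E₅), sq_nonneg E₅]

variable {V : Type*} [Fintype V]

/-- By bilinearity the double sum is the form at the summed flag combinations. These sums vanish for
three equal disjoint cliques with `u`, `v` in one and `w` in another, so nothing is lost there. -/
theorem sum_edgeTerm_nonneg (p q r : V → Bool) :
    0 ≤ ∑ x, ∑ y, edgeTerm (p x) (q x) (r x) (p y) (q y) (r y) := by
  have h := edgeForm_self_nonneg (∑ x, f₁ (p x) (q x) (r x)) (∑ x, f₂ (p x) (q x) (r x))
    (∑ x, f₃ (p x) (q x) (r x)) (∑ x, f₄ (p x) (q x) (r x)) (∑ x, o₁ (p x) (q x) (r x))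
    (∑ x, o₂ (p x) (q x) (r x))
  refine h.trans_eq ?_
  simp only [edgeTerm, edgeForm, Finset.sum_add_distrib, Finset.sum_sub_distrib,
    ← Finset.mul_sum, ← Finset.sum_mul]

theorem sum_pathTerm_nonneg (p q r : V → Bool) :
    0 ≤ ∑ x, ∑ y, pathTerm (p x) (q x) (r x) (p y) (q y) (r y) := by
  have h := pathForm_self_nonneg (∑ x, e₁ (p x) (q x) (r x)) (∑ x, e₂ (p x) (q x) (r x))
    (∑ x, e₃ (p x) (q x) (r x)) (∑ x, e₄ (p x) (q x) (r x)) (∑ x, e₅ (p x) (q x) (r x))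
  refine h.trans_eq ?_
  simp only [pathTerm, pathForm, Finset.sum_add_distrib, Finset.sum_sub_distrib,
    ← Finset.mul_sum, ← Finset.sum_mul]

theorem sum_tripleTerm_nonneg (uv uw vw : Bool) (p q r : V → Bool) :
    0 ≤ ∑ x, ∑ y, tripleTerm uv uw vw (p x) (q x) (r x) (p y) (q y) (r y) := by
  rcases uv with _ | _ <;> rcases uw with _ | _ <;> rcases vw with _ | _ <;>
    simp only [tripleTerm, sum_edgeTerm_nonneg, sum_pathTerm_nonneg, Finset.sum_const_zero, le_refl]

theorem sum_comp_fin {A : Type*} [AddCommMonoid A] {m : ℕ} [DecidableEq V]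
    (F : (Fin m → V) → A) (p : Fin m → Fin m)
    (hp : Function.Injective p) : ∑ x : Fin m → V, F (fun i => x (p i)) = ∑ x, F x :=
  Equiv.sum_comp (Equiv.arrowCongr
    (Equiv.ofBijective p (Finite.injective_iff_bijective.1 hp)).symm (Equiv.refl V)) F

theorem sum_list_comp_fin {m : ℕ} [DecidableEq V] (F : (Fin m → V) → ℤ)
    (l : List (Fin m → Fin m)) (hl : ∀ p ∈ l, Function.Injective p) :
    ∑ x : Fin m → V, (l.map fun p => F fun i => x (p i)).sum = l.length * ∑ x, F x := by
  induction l with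
  | nil => simp
  | cons p l ih =>
    rw [List.forall_mem_cons] at hl
    simp only [List.map_cons, List.sum_cons, Finset.sum_add_distrib, ih hl.2,
      sum_comp_fin F p hl.1, List.length_cons]
    push_cast
    ring

theorem sum_fin_five {A : Type*} [AddCommMonoid A] [DecidableEq V]
    (F : V → V → V → V → V → A) :
    ∑ x : Fin 5 → V, F (x 0) (x 1) (x 2) (x 3) (x 4)
      = ∑ a, ∑ b, ∑ c, ∑ d, ∑ e, F a b c d e := by
  let E : (Fin 5 → V) ≃ V × V × V × V × V :=
    { toFun := fun x => (x 0, x 1, x 2, x 3, x 4)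
      invFun := fun t => ![t.1, t.2.1, t.2.2.1, t.2.2.2.1, t.2.2.2.2]
      left_inv := by
        intro x
        funext i
        fin_cases i <;> rfl
      right_inv := by
        rintro ⟨a, b, c, d, e⟩
        rfl }
  have h := Equiv.sum_comp E (fun t => F t.1 t.2.1 t.2.2.1 t.2.2.2.1 t.2.2.2.2)
  simp only [Fintype.sum_prod_type] at h
  exact h

variable [DecidableEq V] (g : V → V → Bool)

/-- The triple term of a labelled 5-tuple, for its first three entries. -/
def tripleAt (x : Fin 5 → V) : ℤ :=
  tripleTerm (g (x 0) (x 1)) (g (x 0) (x 2)) (g (x 1) (x 2))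
    (g (x 0) (x 3)) (g (x 1) (x 3)) (g (x 2) (x 3))
    (g (x 0) (x 4)) (g (x 1) (x 4)) (g (x 2) (x 4))

/-- The root term of a labelled 5-tuple, rooted at its first entry. -/
def rootAt (x : Fin 5 → V) : ℤ :=
  rootTerm (g (x 0) (x 1)) (g (x 0) (x 2)) (g (x 0) (x 3)) (g (x 0) (x 4)) (g (x 1) (x 2))

theorem sum_tripleAt_nonneg : 0 ≤ ∑ x : Fin 5 → V, tripleAt g x := by
  have h := sum_fin_five (fun u v w x y => tripleTerm (g u v) (g u w) (g v w)
    (g u x) (g v x) (g w x) (g u y) (g v y) (g w y))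
  refine le_of_le_of_eq ?_ h.symm
  exact Finset.sum_nonneg fun u _ => Finset.sum_nonneg fun v _ => Finset.sum_nonneg fun w _ =>
    sum_tripleTerm_nonneg _ _ _ (g u) (g v) (g w)

/-- `pointwise` is averaged over all relabellings. It applies to tuples with repeated entries too,
since `h4` includes reflexivity. -/
theorem sum_tripleAt_le (hs : ∀ x y, g x y = g y x)
    (h4 : ∀ a b c d, (g a b || g a c || g a d || g b c || g b d || g c d) = true) :
    ∑ x : Fin 5 → V, tripleAt g x ≤ 2 * ∑ x : Fin 5 → V, rootAt g x := by
  let P : List (Fin 5 → Fin 5) := [![0, 1, 2, 3, 4], ![0, 1, 3, 2, 4], ![0, 1, 4, 2, 3],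
    ![0, 2, 3, 1, 4], ![0, 2, 4, 1, 3], ![0, 3, 4, 1, 2], ![1, 2, 3, 0, 4], ![1, 2, 4, 0, 3],
    ![1, 3, 4, 0, 2], ![2, 3, 4, 0, 1]]
  let Q : List (Fin 5 → Fin 5) := [![0, 1, 2, 3, 4], ![1, 0, 2, 3, 4], ![2, 0, 1, 3, 4],
    ![3, 0, 1, 2, 4], ![4, 0, 1, 2, 3]]
  let R : List (Fin 5 → Fin 5) := [![0, 1, 2, 3, 4], ![0, 1, 3, 2, 4], ![0, 1, 4, 2, 3],
    ![0, 2, 3, 1, 4], ![0, 2, 4, 1, 3], ![0, 3, 4, 1, 2]]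
  let S : (Fin 5 → V) → ℤ := fun y => (R.map fun r => rootAt g fun i => y (r i)).sum
  have hpt (x : Fin 5 → V) : 3 * (P.map fun p => tripleAt g fun i => x (p i)).sum ≤
      2 * (Q.map fun q => S fun i => x (q i)).sum := by
    have h := pointwise (g (x 0) (x 1)) (g (x 0) (x 2)) (g (x 0) (x 3)) (g (x 0) (x 4))
      (g (x 1) (x 2)) (g (x 1) (x 3)) (g (x 1) (x 4)) (g (x 2) (x 3)) (g (x 2) (x 4))
      (g (x 3) (x 4)) (by simp only [h4, Bool.and_self])
    have h10 := hs (x 1) (x 0)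
    have h20 := hs (x 2) (x 0)
    have h30 := hs (x 3) (x 0)
    have h40 := hs (x 4) (x 0)
    have h21 := hs (x 2) (x 1)
    have h31 := hs (x 3) (x 1)
    have h41 := hs (x 4) (x 1)
    have h32 := hs (x 3) (x 2)
    have h42 := hs (x 4) (x 2)
    have h43 := hs (x 4) (x 3)
    have e3 : ∀ (a b c d e : Fin 5), (![a, b, c, d, e] : Fin 5 → Fin 5) 3 = d := fun _ _ _ _ _ => rfl
    have e4 : ∀ (a b c d e : Fin 5), (![a, b, c, d, e] : Fin 5 → Fin 5) 4 = e := fun _ _ _ _ _ => rfl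
    have e2 : ∀ (a b c d e : Fin 5), (![a, b, c, d, e] : Fin 5 → Fin 5) 2 = c := fun _ _ _ _ _ => rfl
    have e1 : ∀ (a b c d e : Fin 5), (![a, b, c, d, e] : Fin 5 → Fin 5) 1 = b := fun _ _ _ _ _ => rfl
    have e0 : ∀ (a b c d e : Fin 5), (![a, b, c, d, e] : Fin 5 → Fin 5) 0 = a := fun _ _ _ _ _ => rfl
    simp only [rootSum] at h
    simp only [P, Q, S, R, List.map_cons, List.map_nil, List.sum_cons, List.sum_nil, tripleAt, rootAt,
      e0, e1, e2, e3, e4, h10, h20, h30, h40, h21, h31, h41, h32, h42, h43]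
    linarith
  have hsum := Finset.sum_le_sum fun x (_ : x ∈ (Finset.univ : Finset (Fin 5 → V))) => hpt x
  have hP : ∀ p ∈ P, Function.Injective p := by
    intro p hp
    simp only [P, List.mem_cons, List.not_mem_nil, or_false] at hp
    rcases hp with rfl | rfl | rfl | rfl | rfl | rfl | rfl | rfl | rfl | rfl <;> decide
  have hQ : ∀ p ∈ Q, Function.Injective p := by
    intro p hp
    simp only [Q, List.mem_cons, List.not_mem_nil, or_false] at hp
    rcases hp with rfl | rfl | rfl | rfl | rfl <;> decide
  have hR : ∀ p ∈ R, Function.Injective p := by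
    intro p hp
    simp only [R, List.mem_cons, List.not_mem_nil, or_false] at hp
    rcases hp with rfl | rfl | rfl | rfl | rfl | rfl <;> decide
  simp only [← Finset.mul_sum] at hsum
  rw [sum_list_comp_fin _ P hP, sum_list_comp_fin S Q hQ, sum_list_comp_fin _ R hR] at hsum
  simp only [P, Q, R, List.length_cons, List.length_nil] at hsum
  push_cast at hsum
  -- The lists have lengths 10, 5 and 6, so the averaged inequality is 3 · 10 · T ≤ 2 · 5 · 6 · R.
  linarith

theorem sum_rootAt :
    ∑ x : Fin 5 → V, rootAt g x = 2 * Fintype.card V * ∑ v, (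
      (9 * (∑ a, ∑ b, ((g v a && g v b && g a b).toNat : ℤ)) - (Fintype.card V : ℤ) ^ 2)
        * (13 * Fintype.card V - 12 * ∑ a, ((g v a).toNat : ℤ))
      - 2 * Fintype.card V * (Fintype.card V - 3 * ∑ a, ((g v a).toNat : ℤ)) ^ 2) := by
  have h := sum_fin_five (fun v a b c d => rootTerm (g v a) (g v b) (g v c) (g v d) (g a b))
  refine Eq.trans h ?_
  rw [Finset.mul_sum]
  refine Finset.sum_congr rfl fun v _ => ?_
  simp only [rootTerm, Finset.sum_sub_distrib, Finset.sum_const, Finset.card_univ,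
    nsmul_eq_mul, ← Finset.mul_sum, ← Finset.sum_mul]
  ring

/-- The flag algebra inequality: in a reflexive symmetric relation without four pairwise
unrelated points, triples of pairwise related points are, on average over their points weighted
by non-degrees, at least as frequent as in three disjoint cliques. -/
theorem sum_sq_le (hs : ∀ x y, g x y = g y x)
    (h4 : ∀ a b c d, (g a b || g a c || g a d || g b c || g b d || g c d) = true) :
    2 * (Fintype.card V : ℤ) * ∑ v, ((Fintype.card V : ℤ) - 3 * ∑ a, ((g v a).toNat : ℤ)) ^ 2 ≤
    ∑ v, (9 * (∑ a, ∑ b, ((g v a && g v b && g a b).toNat : ℤ)) - (Fintype.card V : ℤ) ^ 2)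
        * (13 * Fintype.card V - 12 * ∑ a, ((g v a).toNat : ℤ)) := by
  have h := (sum_tripleAt_nonneg g).trans (sum_tripleAt_le g hs h4)
  rw [sum_rootAt, Finset.sum_sub_distrib, ← Finset.mul_sum] at h
  rcases isEmpty_or_nonempty V with hV | hV
  · simp
  · have hn : 0 < (Fintype.card V : ℤ) := by exact_mod_cast Fintype.card_pos
    have h2 : 0 < 2 * (2 * (Fintype.card V : ℤ)) := by positivity
    rw [← mul_assoc] at h
    have := nonneg_of_mul_nonneg_right h h2
    linarith

end FlagCertificate

/-! ### Closed degrees, closed triangle counts and vertex cloning. -/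

section Counting

variable {V : Type*}

/-- The indicator of the relation "equal or adjacent". -/
noncomputable def closedAdj (G : SimpleGraph V) (x y : V) : ℤ :=
  open Classical in if x = y ∨ G.Adj x y then 1 else 0

theorem closedAdj_comm (G : SimpleGraph V) (x y : V) : G.closedAdj x y = G.closedAdj y x := by
  unfold closedAdj
  rw [G.adj_comm, eq_comm (a := x)]

theorem closedAdj_nonneg (G : SimpleGraph V) (x y : V) : 0 ≤ G.closedAdj x y := by
  unfold closedAdj
  split_ifs <;> simp

theorem closedAdj_le_one (G : SimpleGraph V) (x y : V) : G.closedAdj x y ≤ 1 := by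
  unfold closedAdj
  split_ifs <;> simp

theorem closedAdj_self (G : SimpleGraph V) (x : V) : G.closedAdj x x = 1 := by
  simp [closedAdj]

theorem IndepSetFree.exists_closedAdj {G : SimpleGraph V} (h : G.IndepSetFree 4) (a b c d : V) :
    (a = b ∨ G.Adj a b) ∨ (a = c ∨ G.Adj a c) ∨ (a = d ∨ G.Adj a d) ∨ (b = c ∨ G.Adj b c) ∨
      (b = d ∨ G.Adj b d) ∨ (c = d ∨ G.Adj c d) := by
  classical
  by_contra! hn
  obtain ⟨⟨h1, h1'⟩, ⟨h2, h2'⟩, ⟨h3, h3'⟩, ⟨h4, h4'⟩, ⟨h5, h5'⟩, ⟨h6, h6'⟩⟩ := hn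
  rw [← cliqueFree_compl] at h
  refine h {a, b, c, d} ?_
  rw [isNClique_iff]
  refine ⟨?_, ?_⟩
  · rw [isClique_compl]
    intro x hx y hy hxy
    simp only [Finset.coe_insert, Finset.coe_singleton, Set.mem_insert_iff,
      Set.mem_singleton_iff] at hx hy
    rcases hx with rfl | rfl | rfl | rfl <;> rcases hy with rfl | rfl | rfl | rfl <;>
      simp_all [G.adj_comm]
  · repeat rw [Finset.card_insert_of_notMem (by simp [*])]
    simp

theorem indepSetFree_four_iff {G : SimpleGraph V} : G.IndepSetFree 4 ↔ ∀ a b c d : V,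
    (a = b ∨ G.Adj a b) ∨ (a = c ∨ G.Adj a c) ∨ (a = d ∨ G.Adj a d) ∨ (b = c ∨ G.Adj b c) ∨
      (b = d ∨ G.Adj b d) ∨ (c = d ∨ G.Adj c d) := by
  refine ⟨fun h => h.exists_closedAdj, fun h => ?_⟩
  rw [← cliqueFree_compl, cliqueFree_iff]
  refine ⟨fun f => ?_⟩
  have key (i j : Fin 4) (hij : i ≠ j) : ¬ (f i = f j ∨ G.Adj (f i) (f j)) := by
    have hxy : Gᶜ.Adj (f i) (f j) := f.toHom.map_adj hij
    exact fun hn => hn.elim hxy.1 hxy.2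
  rcases h (f 0) (f 1) (f 2) (f 3) with h | h | h | h | h | h <;> exact key _ _ (by decide) h

/-- Blowing up (and deleting) vertices of `G`: each vertex `v` becomes a copy of `φ v`, and copies
of the same vertex are adjacent. -/
def pull (G : SimpleGraph V) (φ : V → V) : SimpleGraph V where
  Adj a b := a ≠ b ∧ (φ a = φ b ∨ G.Adj (φ a) (φ b))
  symm := ⟨fun _ _ h => ⟨h.1.symm, h.2.imp Eq.symm Adj.symm⟩⟩
  loopless := ⟨fun _ h => h.1 rfl⟩

theorem closedAdj_pull (G : SimpleGraph V) (φ : V → V) (a b : V) :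
    (G.pull φ).closedAdj a b = G.closedAdj (φ a) (φ b) := by
  unfold closedAdj
  by_cases h : a = b
  · simp [h]
  · by_cases h' : φ a = φ b ∨ G.Adj (φ a) (φ b)
    · rw [if_pos h', if_pos (Or.inr ⟨h, h'⟩)]
    · rw [if_neg h', if_neg fun hn => hn.elim h fun hn => h' hn.2]

theorem IndepSetFree.pull {G : SimpleGraph V} (h : G.IndepSetFree 4) (φ : V → V) :
    (G.pull φ).IndepSetFree 4 := by
  rw [indepSetFree_four_iff] at h ⊢
  intro a b c d
  have key {x y : V} (hxy : φ x = φ y ∨ G.Adj (φ x) (φ y)) : x = y ∨ (G.pull φ).Adj x y :=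
    or_iff_not_imp_left.2 fun hne => ⟨hne, hxy⟩
  exact (h (φ a) (φ b) (φ c) (φ d)).imp key <| Or.imp key <| Or.imp key <| Or.imp key <|
    Or.imp key key

variable [Fintype V]

/-- The number of vertices equal or adjacent to `v`. -/
noncomputable def closedDeg (G : SimpleGraph V) (v : V) : ℤ := ∑ a, G.closedAdj v a

/-- The number of ordered pairs of equal or adjacent vertices in the closed neighbourhood. -/
noncomputable def closedTri (G : SimpleGraph V) (v : V) : ℤ :=
  ∑ a, ∑ b, G.closedAdj v a * G.closedAdj v b * G.closedAdj a b

theorem closedDeg_nonneg (G : SimpleGraph V) (v : V) : 0 ≤ G.closedDeg v :=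
  Finset.sum_nonneg fun _ _ => G.closedAdj_nonneg _ _

theorem closedDeg_le (G : SimpleGraph V) (v : V) : G.closedDeg v ≤ Fintype.card V := by
  refine (Finset.sum_le_sum fun a _ => G.closedAdj_le_one v a).trans ?_
  simp

theorem IndepSetFree.sum_sq_le {G : SimpleGraph V} (h : G.IndepSetFree 4) :
    2 * (Fintype.card V : ℤ) * ∑ v, ((Fintype.card V : ℤ) - 3 * G.closedDeg v) ^ 2 ≤
    ∑ v, (9 * G.closedTri v - (Fintype.card V : ℤ) ^ 2)
        * (13 * Fintype.card V - 12 * G.closedDeg v) := by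
  classical
  have hc (x y : V) : G.closedAdj x y = ((decide (x = y ∨ G.Adj x y)).toNat : ℤ) := by
    unfold closedAdj
    by_cases h : x = y ∨ G.Adj x y <;> simp [h]
  have ha (p q r : Bool) : ((p && q && r).toNat : ℤ) = p.toNat * q.toNat * r.toNat := by
    cases p <;> cases q <;> cases r <;> rfl
  have := FlagCertificate.sum_sq_le (fun x y => decide (x = y ∨ G.Adj x y))
    (fun x y => by simp only [eq_comm (a := x), G.adj_comm x])
    (fun a b c d => by
      simpa only [Bool.or_eq_true, decide_eq_true_eq, or_assoc] using h.exists_closedAdj a b c d)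
  simpa only [ha, ← hc, closedDeg, closedTri] using this

theorem card_triangle_triples [DecidableEq V] (G : SimpleGraph V) [DecidableRel G.Adj] :
    Finset.card {t : V × V × V | G.Adj t.1 t.2.1 ∧ G.Adj t.1 t.2.2 ∧ G.Adj t.2.1 t.2.2}
      = 6 * Finset.card (G.cliqueFinset 3) := by
  rw [Finset.card_eq_sum_card_fiberwise (t := G.cliqueFinset 3)
    (f := fun t : V × V × V => ({t.1, t.2.1, t.2.2} : Finset V))]
  · rw [mul_comm, ← smul_eq_mul, ← Finset.sum_const]
    refine Finset.sum_congr rfl fun s hs => ?_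
    rw [mem_cliqueFinset_iff, is3Clique_iff] at hs
    obtain ⟨a, b, c, hab, hac, hbc, rfl⟩ := hs
    have : (Finset.filter (fun t : V × V × V => ({t.1, t.2.1, t.2.2} : Finset V) = {a, b, c})
        {t : V × V × V | G.Adj t.1 t.2.1 ∧ G.Adj t.1 t.2.2 ∧ G.Adj t.2.1 t.2.2})
        = {(a, b, c), (a, c, b), (b, a, c), (b, c, a), (c, a, b), (c, b, a)} := by
      ext ⟨x, y, z⟩
      simp only [Finset.mem_filter, Finset.mem_univ, true_and, Finset.mem_insert,
        Finset.mem_singleton, Prod.mk.injEq]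
      constructor
      · rintro ⟨⟨hxy, hxz, hyz⟩, he⟩
        have hx : x ∈ ({a, b, c} : Finset V) := he ▸ by simp
        have hy : y ∈ ({a, b, c} : Finset V) := he ▸ by simp
        have hz : z ∈ ({a, b, c} : Finset V) := he ▸ by simp
        have h1 := hxy.ne
        have h2 := hxz.ne
        have h3 := hyz.ne
        simp only [Finset.mem_insert, Finset.mem_singleton] at hx hy hz
        clear he
        grind
      · rintro (⟨rfl, rfl, rfl⟩ | ⟨rfl, rfl, rfl⟩ | ⟨rfl, rfl, rfl⟩ | ⟨rfl, rfl, rfl⟩ |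
          ⟨rfl, rfl, rfl⟩ | ⟨rfl, rfl, rfl⟩) <;>
          refine ⟨⟨by simp [hab, hac, hbc, hab.symm, hac.symm, hbc.symm],
            by simp [hab, hac, hbc, hab.symm, hac.symm, hbc.symm],
            by simp [hab, hac, hbc, hab.symm, hac.symm, hbc.symm]⟩, ?_⟩ <;>
          ext w <;> simp only [Finset.mem_insert, Finset.mem_singleton] <;> tauto
    rw [this]
    have h1 := hab.ne
    have h2 := hac.ne
    have h3 := hbc.ne
    have h1' := hab.ne'
    have h2' := hac.ne'
    have h3' := hbc.ne'
    repeat rw [Finset.card_insert_of_notMem (by simp [*])]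
    simp
  · rintro ⟨a, b, c⟩ ht
    simp only [Finset.coe_filter, Finset.mem_univ, true_and, Set.mem_ofPred_eq] at ht
    simp only [Finset.mem_coe, mem_cliqueFinset_iff, is3Clique_iff]
    exact ⟨a, b, c, ht.1, ht.2.1, ht.2.2, rfl⟩

theorem numCliques_eq_card [DecidableEq V] (G : SimpleGraph V) [DecidableRel G.Adj] (k : ℕ) :
    G.numCliques k = Finset.card (G.cliqueFinset k) := by
  rw [numCliques, ← coe_cliqueFinset, Set.ncard_coe_finset]

/-- Among the ordered triples counted by `closedTri`, the degenerate ones are three families indexed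
by ordered edges and the n constant triples. `closedDeg` sums to the number of ordered edges plus n.
-/
theorem six_mul_numCliques (G : SimpleGraph V) :
    6 * (G.numCliques 3 : ℤ)
      = ∑ v, G.closedTri v - 3 * ∑ v, G.closedDeg v + 2 * Fintype.card V := by
  classical
  let A : V → V → ℤ := fun x y => if G.Adj x y then 1 else 0
  let δ : V → V → ℤ := fun x y => if x = y then 1 else 0
  have hc (x y : V) : G.closedAdj x y = A x y + δ x y := by
    simp only [closedAdj, A, δ]
    by_cases h : x = y
    · subst h; simp
    · simp [h]
  have hAA (x y : V) : A x y * A x y = A x y := by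
    simp only [A]; split_ifs <;> rfl
  have hA0 (x : V) : A x x = 0 := by simp [A]
  have hAs (x y : V) : A x y = A y x := by simp only [A, G.adj_comm]
  have h6 : 6 * (G.numCliques 3 : ℤ) = ∑ a, ∑ b, ∑ c, A a b * A a c * A b c := by
    rw [numCliques_eq_card]
    have := G.card_triangle_triples
    rw [Finset.card_filter, Fintype.sum_prod_type] at this
    simp only [Fintype.sum_prod_type] at this
    have h := congrArg (Nat.cast : ℕ → ℤ) this
    push_cast at h
    rw [← h]
    refine Finset.sum_congr rfl fun a _ => Finset.sum_congr rfl fun b _ =>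
      Finset.sum_congr rfl fun c _ => ?_
    simp only [A, ite_and]
    split_ifs <;> rfl
  rw [h6]
  have hW : ∑ v, G.closedTri v
      = ∑ a, ∑ b, ∑ c, A a b * A a c * A b c + 3 * ∑ a, ∑ b, A a b + Fintype.card V := by
    simp only [closedTri, hc, add_mul, mul_add, Finset.sum_add_distrib]
    simp only [δ, mul_ite, ite_mul, mul_one, mul_zero, one_mul, zero_mul, Finset.sum_ite_eq,
      Finset.mem_univ, if_true, hAA, hA0]
    have e₁ (x : V) : (∑ y, ∑ z, if x = y then A x z * A y z else 0) = ∑ z, A x z := by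
      rw [Finset.sum_comm]
      simp [hAA]
    have e₂ (x y : V) : A x y * A y x = A x y := by rw [hAs y x, hAA]
    simp only [e₁, e₂, Finset.sum_const_zero, Finset.sum_const, Finset.card_univ, nsmul_eq_mul]
    ring
  have hS : ∑ v, G.closedDeg v = ∑ a, ∑ b, A a b + Fintype.card V := by
    simp [closedDeg, hc, Finset.sum_add_distrib, δ]
  rw [hW, hS]
  ring

/-- Applied once per summation variable, this computes the effect of turning `v` into a clone of
`u`. -/
theorem sum_comp_update_id [DecidableEq V] (h : V → ℤ) (u v : V) :
    ∑ a, h (Function.update id v u a) = ∑ a, h a + h u - h v := by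
  have h1 (a : V) : h (Function.update id v u a) = h a + if a = v then h u - h v else 0 := by
    by_cases ha : a = v
    · subst ha; simp
    · simp [ha]
  simp only [h1, Finset.sum_add_distrib, Finset.sum_ite_eq', Finset.mem_univ, if_true]
  ring

theorem sum_closedDeg_pull_update [DecidableEq V] (G : SimpleGraph V) (u v : V) :
    ∑ a, (G.pull (Function.update id v u)).closedDeg a
      = ∑ a, G.closedDeg a + 2 * G.closedDeg u - 2 * G.closedDeg v + 2 - 2 * G.closedAdj u v := by
  have h1 (w : V) : ∑ x, G.closedAdj x w = G.closedDeg w :=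
    Finset.sum_congr rfl fun x _ => G.closedAdj_comm x w
  have h2 (x : V) : ∑ b, G.closedAdj x (Function.update id v u b)
      = G.closedDeg x + G.closedAdj x u - G.closedAdj x v :=
    sum_comp_update_id (fun y => G.closedAdj x y) u v
  have h3 : ∑ a, (G.pull (Function.update id v u)).closedDeg a
      = ∑ a, (fun x => G.closedDeg x + G.closedAdj x u - G.closedAdj x v)
        (Function.update id v u a) := by
    refine Finset.sum_congr rfl fun a _ => ?_
    rw [closedDeg]
    simp only [closedAdj_pull, h2]
  rw [h3, sum_comp_update_id (fun x => G.closedDeg x + G.closedAdj x u - G.closedAdj x v)]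
  simp only [Finset.sum_add_distrib, Finset.sum_sub_distrib, h1, closedAdj_self,
    G.closedAdj_comm v u]
  ring

theorem sum_closedTri_pull_update [DecidableEq V] (G : SimpleGraph V) (u v : V) :
    ∑ a, (G.pull (Function.update id v u)).closedTri a
      = ∑ a, G.closedTri a + 3 * G.closedTri u - 3 * G.closedTri v + 3 * G.closedDeg u
        + 3 * G.closedDeg v
        - 6 * ∑ x, G.closedAdj u v * G.closedAdj u x * G.closedAdj v x := by
  -- `F` is symmetric in its three arguments and collapses to `closedAdj` when two coincide; `r`
  -- counts closed common neighbours of related pairs.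
  let φ : V → V := Function.update id v u
  let F : V → V → V → ℤ := fun x y z => G.closedAdj x y * G.closedAdj x z * G.closedAdj y z
  let r : V → V → ℤ := fun x y => ∑ z, F x y z
  have hsq (x y : V) : G.closedAdj x y * G.closedAdj x y = G.closedAdj x y := by
    unfold closedAdj; split_ifs <;> rfl
  have hF1 (x y z : V) : F x y z = F y x z := by
    simp only [F, G.closedAdj_comm x y]; ring
  have hF2 (x y z : V) : F x y z = F x z y := by
    simp only [F, G.closedAdj_comm y z]; ring
  have hFd (x y : V) : F x y y = G.closedAdj x y := by
    simp only [F, hsq, closedAdj_self, mul_one]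
  have hFd₁ (x y : V) : F x x y = G.closedAdj x y := by
    simp only [F, hsq, closedAdj_self, one_mul]
  have hFd₂ (x y : V) : F x y x = G.closedAdj x y := by rw [hF2, hFd₁]
  have hr (x y : V) : ∑ z, F x z y = r x y := Finset.sum_congr rfl fun z _ => hF2 x z y
  have hr' (x y : V) : ∑ z, F z x y = r x y :=
    Finset.sum_congr rfl fun z _ => by rw [hF1, hF2]
  have hrs (x y : V) : r x y = r y x := Finset.sum_congr rfl fun z _ => hF1 x y z
  have hrd (x : V) : r x x = G.closedDeg x :=
    Finset.sum_congr rfl fun z _ => hFd₁ x z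
  have ht (x : V) : ∑ y, r x y = G.closedTri x := rfl
  have hc (w : V) : ∑ x, G.closedAdj x w = G.closedDeg w :=
    Finset.sum_congr rfl fun x _ => G.closedAdj_comm x w
  have h1 (x y : V) : ∑ c, F x y (φ c) = r x y + F x y u - F x y v :=
    sum_comp_update_id (fun z => F x y z) u v
  have h2 (x : V) : ∑ b, ∑ c, F x (φ b) (φ c)
      = G.closedTri x + 2 * r x u - 2 * r x v + G.closedAdj x u - 2 * F x u v
        + G.closedAdj x v := by
    simp only [h1]
    rw [sum_comp_update_id (fun y => r x y + F x y u - F x y v) u v]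
    simp only [Finset.sum_add_distrib, Finset.sum_sub_distrib, ht, hr, hFd, hF2 x v u]
    ring
  have h3 : ∑ a, (G.pull φ).closedTri a = ∑ a, (fun x => G.closedTri x + 2 * r x u - 2 * r x v
      + G.closedAdj x u - 2 * F x u v + G.closedAdj x v) (φ a) := by
    refine Finset.sum_congr rfl fun a _ => ?_
    refine Eq.trans ?_ (h2 (φ a))
    rw [closedTri]
    simp only [closedAdj_pull, F]
  have hru (w : V) : ∑ x, r x w = G.closedTri w := by simp only [hrs _ w, ht]
  rw [h3, sum_comp_update_id (fun x => G.closedTri x + 2 * r x u - 2 * r x v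
    + G.closedAdj x u - 2 * F x u v + G.closedAdj x v)]
  simp only [Finset.sum_add_distrib, Finset.sum_sub_distrib, ← Finset.mul_sum, hru, hr', hc, hrd,
    closedAdj_self, G.closedAdj_comm v u, hrs v u, hFd₁, hFd₂]
  change _ = _ - 6 * r u v
  ring

/-- In a graph with independence number at most three and the least number of triangles, replacing
a vertex by a copy of another one shows that all vertices lie in about equally many triangles. -/
theorem closedTri_le_of_forall_numCliques_le {G : SimpleGraph V} (h : G.IndepSetFree 4)
    (hmin : ∀ G' : SimpleGraph V, G'.IndepSetFree 4 → G.numCliques 3 ≤ G'.numCliques 3)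
    (u v : V) : G.closedTri v ≤ G.closedTri u + 3 * Fintype.card V := by
  classical
  have h1 := G.six_mul_numCliques
  have h2 := (G.pull (Function.update id v u)).six_mul_numCliques
  rw [sum_closedDeg_pull_update, sum_closedTri_pull_update] at h2
  have h3 : (G.numCliques 3 : ℤ) ≤ (G.pull (Function.update id v u)).numCliques 3 := by
    exact_mod_cast hmin _ (h.pull _)
  have h4 : 0 ≤ ∑ x, G.closedAdj u v * G.closedAdj u x * G.closedAdj v x :=
    Finset.sum_nonneg fun x _ => mul_nonneg (mul_nonneg (G.closedAdj_nonneg _ _)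
      (G.closedAdj_nonneg _ _)) (G.closedAdj_nonneg _ _)
  have h5 := G.closedDeg_le v
  have h6 := G.closedDeg_nonneg u
  have h7 := G.closedAdj_le_one u v
  linarith

end Counting

/-! ### From near-cliques to an exact partition into cliques. -/

section Stability

variable {V : Type*} [DecidableEq V] (N : V → Finset V)

theorem exists_notMem_of_sum_lt (D E : Finset V)
    (h : ∑ y ∈ D, ((N y ∩ E).card : ℝ) < D.card * E.card) : ∃ y ∈ D, ∃ z ∈ E, z ∉ N y := by
  by_contra! hn
  refine h.not_ge ?_
  rw [← nsmul_eq_mul, ← Finset.sum_const]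
  refine Finset.sum_le_sum fun y hy => ?_
  rw [Finset.inter_eq_right.2 (hn y hy)]

/-- Averaging gives `x` with at most s / 2 neighbours in `D₂` and `D₃` together. More than s / 2
vertices remain in each, and their more than s² / 4 > X pairs cannot all be related. -/
theorem exists_triple_notMem {s X : ℝ} (hs : 0 < s) (hX : 4 * X < s ^ 2) (D₁ D₂ D₃ : Finset V)
    (h₁ : s < D₁.card) (h₂ : s < D₂.card) (h₃ : s < D₃.card)
    (h₁₂ : ∑ x ∈ D₁, ((N x ∩ D₂).card : ℝ) ≤ X) (h₁₃ : ∑ x ∈ D₁, ((N x ∩ D₃).card : ℝ) ≤ X)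
    (h₂₃ : ∑ x ∈ D₂, ((N x ∩ D₃).card : ℝ) ≤ X) :
    ∃ x ∈ D₁, ∃ y ∈ D₂, ∃ z ∈ D₃, y ∉ N x ∧ z ∉ N x ∧ z ∉ N y := by
  have hne : D₁.Nonempty := by
    rw [← Finset.card_pos]
    exact_mod_cast hs.trans h₁
  obtain ⟨x, hx, hxs⟩ : ∃ x ∈ D₁, ((N x ∩ D₂).card : ℝ) + (N x ∩ D₃).card ≤ s / 2 := by
    refine Finset.exists_le_of_sum_le hne ?_
    rw [Finset.sum_add_distrib, Finset.sum_const, nsmul_eq_mul]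
    nlinarith
  have hc (D : Finset V) : ((D \ N x).card : ℝ) = D.card - (N x ∩ D).card := by
    rw [Finset.inter_comm, ← Finset.card_sdiff_add_card_inter D (N x)]
    push_cast
    ring
  have hp₂ : (0 : ℝ) ≤ (N x ∩ D₂).card := by positivity
  have hp₃ : (0 : ℝ) ≤ (N x ∩ D₃).card := by positivity
  have hc₂ := hc D₂
  have hc₃ := hc D₃
  have hlt : ∑ y ∈ D₂ \ N x, ((N y ∩ (D₃ \ N x)).card : ℝ) < (D₂ \ N x).card * (D₃ \ N x).card := by
    refine lt_of_le_of_lt (b := X) ?_ (by nlinarith)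
    refine le_trans ?_ h₂₃
    refine (Finset.sum_le_sum fun y _ => ?_).trans
      (Finset.sum_le_sum_of_subset_of_nonneg Finset.sdiff_subset fun _ _ _ => by positivity)
    exact_mod_cast Finset.card_le_card (Finset.inter_subset_inter_left Finset.sdiff_subset)
  obtain ⟨y, hy, z, hz, hyz⟩ := exists_notMem_of_sum_lt N _ _ hlt
  rw [Finset.mem_sdiff] at hy hz
  exact ⟨x, hx, y, hy.1, z, hz.1, hy.2, hz.2, hyz⟩

/-- A set with few missing pairs spans many pairs within each subset. -/
theorem sq_card_sub_le_sum (B P : Finset V) (hP : P ⊆ B) :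
    (P.card : ℝ) ^ 2 - ∑ x ∈ B, ((B \ N x).card : ℝ) ≤ ∑ x ∈ P, ((P ∩ N x).card : ℝ) := by
  have h1 : ∑ x ∈ P, ((P \ N x).card : ℝ) ≤ ∑ x ∈ B, ((B \ N x).card : ℝ) := by
    refine (Finset.sum_le_sum fun x _ => ?_).trans
      (Finset.sum_le_sum_of_subset_of_nonneg hP fun _ _ _ => by positivity)
    exact_mod_cast Finset.card_le_card (Finset.sdiff_subset_sdiff hP subset_rfl)
  have h2 : ∑ x ∈ P, ((P \ N x).card : ℝ) + ∑ x ∈ P, ((P ∩ N x).card : ℝ) = (P.card : ℝ) ^ 2 := by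
    rw [← Finset.sum_add_distrib, sq, ← nsmul_eq_mul, ← Finset.sum_const]
    refine Finset.sum_congr rfl fun x _ => ?_
    exact_mod_cast Finset.card_sdiff_add_card_inter P (N x)
  linarith

/-- If `v` is close to a near-clique `B`, then it has few neighbours in any other near-clique. -/
theorem card_inter_sdiff_le {n e δ : ℝ} (v : V) (B B' : Finset V)
    (hB : ∑ x ∈ B, ((B \ N x).card : ℝ) ≤ 2 * e * n ^ 2)
    (hB' : ∑ x ∈ B', ((B' \ N x).card : ℝ) ≤ 2 * e * n ^ 2)
    (hcard : n / 3 - e * n - δ * n ≤ (B ∩ N v).card) (h0 : 0 ≤ n / 3 - e * n - δ * n)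
    (htri : ∑ x ∈ N v, ((N v ∩ N x).card : ℝ) ≤ (1 / 9 + e) * n ^ 2) :
    (((N v ∩ B') \ B).card : ℝ) ^ 2 ≤ (1 / 9 + 5 * e - (1 / 3 - e - δ) ^ 2) * n ^ 2 := by
  have h1 := sq_card_sub_le_sum N B (B ∩ N v) Finset.inter_subset_left
  have h2 := sq_card_sub_le_sum N B' ((N v ∩ B') \ B)
    (Finset.sdiff_subset.trans Finset.inter_subset_right)
  have hd : Disjoint (B ∩ N v) ((N v ∩ B') \ B) :=
    Finset.disjoint_of_subset_left Finset.inter_subset_left Finset.disjoint_sdiff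
  have h3 : ∑ x ∈ B ∩ N v, (((B ∩ N v) ∩ N x).card : ℝ)
      + ∑ x ∈ (N v ∩ B') \ B, ((((N v ∩ B') \ B) ∩ N x).card : ℝ)
      ≤ ∑ x ∈ N v, ((N v ∩ N x).card : ℝ) := by
    have hsub : (B ∩ N v) ∪ ((N v ∩ B') \ B) ⊆ N v :=
      Finset.union_subset Finset.inter_subset_right
        (Finset.sdiff_subset.trans Finset.inter_subset_left)
    refine le_trans ?_ (Finset.sum_le_sum_of_subset_of_nonneg hsub fun _ _ _ => by positivity)
    rw [Finset.sum_union hd]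
    refine add_le_add (Finset.sum_le_sum fun x _ => ?_) (Finset.sum_le_sum fun x _ => ?_)
    · exact_mod_cast Finset.card_le_card
        (Finset.inter_subset_inter_right Finset.inter_subset_right)
    · exact_mod_cast Finset.card_le_card
        (Finset.inter_subset_inter_right (Finset.sdiff_subset.trans Finset.inter_subset_left))
  have h4 := pow_le_pow_left₀ h0 hcard 2
  nlinarith

variable [Fintype V]

/-- A vertex far from all three `B j` would complete an independent 4-set with one vertex of each. A
vertex close to `B j` has few neighbours in the other two, as `htri` leaves no room for more. So two
unrelated vertices close to the same `B j` would extend to an independent 4-set by unrelated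
vertices of the other two sets. -/
theorem exists_partition_of_near_cliques
    (hfour : ∀ a b c d, b ∈ N a ∨ c ∈ N a ∨ d ∈ N a ∨ c ∈ N b ∨ d ∈ N b ∨ d ∈ N c)
    {n e : ℝ} (hn : 0 < n) (he : e = 1 / 10 ^ 10) (B : Fin 3 → Finset V)
    (hcard : ∀ j, n / 3 - e * n ≤ (B j).card)
    (hinter : ∀ i j, i ≠ j → ((B i ∩ B j).card : ℝ) ≤ 3 * e * n)
    (hmiss : ∀ j, ∑ x ∈ B j, ((B j \ N x).card : ℝ) ≤ 2 * e * n ^ 2)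
    (hcross : ∀ i j, i ≠ j → ∑ x ∈ B i, ((N x ∩ B j).card : ℝ) ≤ 6 * e * n ^ 2)
    (htri : ∀ v, ∑ x ∈ N v, ((N v ∩ N x).card : ℝ) ≤ (1 / 9 + e) * n ^ 2) :
    ∃ C : Fin 3 → Finset V, (∀ i j, i ≠ j → Disjoint (C i) (C j)) ∧ (∀ v, ∃ i, v ∈ C i) ∧
      ∀ i, ∀ x ∈ C i, ∀ y ∈ C i, y ∈ N x := by
  have hn2 : 0 < n ^ 2 := by positivity
  have hcross' (i j : Fin 3) (hij : i ≠ j) (D E : Finset V) (hD : D ⊆ B i) (hE : E ⊆ B j) :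
      ∑ x ∈ D, ((N x ∩ E).card : ℝ) ≤ 6 * e * n ^ 2 := by
    refine le_trans ?_ (hcross i j hij)
    refine (Finset.sum_le_sum fun y _ => ?_).trans
      (Finset.sum_le_sum_of_subset_of_nonneg hD fun _ _ _ => by positivity)
    exact_mod_cast Finset.card_le_card (Finset.inter_subset_inter_left hE)
  have hsplit (j : Fin 3) (v : V) :
      ((B j \ N v).card : ℝ) + (B j ∩ N v).card = (B j).card := by
    exact_mod_cast Finset.card_sdiff_add_card_inter (B j) (N v)
  have hnear (v : V) : ∃ j, ((B j \ N v).card : ℝ) ≤ n / 400 := by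
    by_contra! hv
    obtain ⟨x, hx, y, hy, z, hz, hxy, hxz, hyz⟩ := exists_triple_notMem N
      (s := n / 400) (X := 6 * e * n ^ 2) (by positivity) (by subst he; nlinarith)
      (B 0 \ N v) (B 1 \ N v) (B 2 \ N v) (hv 0) (hv 1) (hv 2)
      (hcross' 0 1 (by decide) _ _ Finset.sdiff_subset Finset.sdiff_subset)
      (hcross' 0 2 (by decide) _ _ Finset.sdiff_subset Finset.sdiff_subset)
      (hcross' 1 2 (by decide) _ _ Finset.sdiff_subset Finset.sdiff_subset)
    rw [Finset.mem_sdiff] at hx hy hz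
    rcases hfour v x y z with h | h | h | h | h | h
    exacts [hx.2 h, hy.2 h, hz.2 h, hxy h, hxz h, hyz h]
  have hfar (v : V) (j l : Fin 3) (hjl : j ≠ l) (hv : ((B j \ N v).card : ℝ) ≤ n / 400) :
      ((N v ∩ B l).card : ℝ) ≤ n / 20 + 3 * e * n := by
    have h1 := card_inter_sdiff_le N (e := e) (δ := 1 / 400) v (B j) (B l) (hmiss j) (hmiss l)
      (by linarith [hcard j, hsplit j v]) (by subst he; linarith) (htri v)
    have h2 : (((N v ∩ B l) \ B j).card : ℝ) ≤ n / 20 := by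
      refine le_of_sq_le_sq ?_ (by positivity)
      refine h1.trans ?_
      subst he
      nlinarith
    have h3 : ((N v ∩ B l).card : ℝ) ≤ ((N v ∩ B l) \ B j).card + (B j ∩ B l).card := by
      have : (N v ∩ B l).card ≤ (((N v ∩ B l) \ B j) ∪ (B j ∩ B l)).card := by
        refine Finset.card_le_card fun x hx => ?_
        simp only [Finset.mem_union, Finset.mem_sdiff, Finset.mem_inter] at hx ⊢
        tauto
      exact_mod_cast this.trans (Finset.card_union_le _ _)
    linarith [hinter j l hjl]
  -- The threshold n / 400 has square above 24 e n², as `exists_triple_notMem` needs, yet is small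
  -- enough for the bound n / 20 in `hfar`.
  refine ⟨fun j => {v | ((B j \ N v).card : ℝ) ≤ n / 400}, ?_, ?_, ?_⟩
  · intro i j hij
    rw [Finset.disjoint_left]
    intro v hvi hvj
    simp only [Finset.mem_filter, Finset.mem_univ, true_and] at hvi hvj
    have h1 := hfar v i j hij hvi
    have h2 := hsplit j v
    have h3 := hcard j
    rw [Finset.inter_comm] at h1
    subst he
    linarith
  · intro v
    simpa using hnear v
  · intro j x hx y hy
    simp only [Finset.mem_filter, Finset.mem_univ, true_and] at hx hy
    have hthree : ∀ j : Fin 3, ∃ l m, j ≠ l ∧ j ≠ m ∧ l ≠ m := by decide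
    obtain ⟨l, m, hl, hm, hlm⟩ := hthree j
    by_contra hxy
    have hbig (i : Fin 3) (hi : j ≠ i) : n / 10 ≤ (B i \ (N x ∪ N y)).card := by
      have h1 := hfar x j i hi hx
      have h2 := hfar y j i hi hy
      have h3 := hcard i
      have h4 : ((B i).card : ℝ) ≤ (B i \ (N x ∪ N y)).card + (N x ∩ B i).card
          + (N y ∩ B i).card := by
        have : (B i).card ≤ ((B i \ (N x ∪ N y)) ∪ (N x ∩ B i) ∪ (N y ∩ B i)).card := by
          refine Finset.card_le_card fun x hx => ?_
          simp only [Finset.mem_union, Finset.mem_sdiff, Finset.mem_inter] at hx ⊢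
          tauto
        exact_mod_cast (this.trans (Finset.card_union_le _ _)).trans
          (Nat.add_le_add_right (Finset.card_union_le _ _) _)
      subst he
      linarith
    have hl' := hbig l hl
    have hm' := hbig m hm
    obtain ⟨z, hz, w, hw, hzw⟩ := exists_notMem_of_sum_lt N (B l \ (N x ∪ N y))
      (B m \ (N x ∪ N y)) (lt_of_le_of_lt
        (hcross' l m hlm _ _ Finset.sdiff_subset Finset.sdiff_subset) (by
          have : (n / 10) * (n / 10) ≤ ((B l \ (N x ∪ N y)).card : ℝ) * (B m \ (N x ∪ N y)).card :=
            mul_le_mul hl' hm' (by positivity) (by positivity)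
          subst he
          nlinarith))
    simp only [Finset.mem_sdiff, Finset.mem_union, not_or] at hz hw
    rcases hfour x y z w with h | h | h | h | h | h
    exacts [hxy h, hz.2.1 h, hw.2.1 h, hz.2.2 h, hw.2.2 h, hzw h]

/-- The near-cliques are the closed neighbourhoods of three pairwise unrelated vertices outside `T`.
By `hfour` they cover `V`, and as each has about n / 3 elements, they hardly overlap. -/
theorem exists_partition_of_typical
    (hfour : ∀ a b c d, b ∈ N a ∨ c ∈ N a ∨ d ∈ N a ∨ c ∈ N b ∨ d ∈ N b ∨ d ∈ N c)
    {n e : ℝ} (hn : 0 < n) (hnV : n = Fintype.card V) (he : e = 1 / 10 ^ 10)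
    (htri : ∀ v, |∑ x ∈ N v, ((N v ∩ N x).card : ℝ) - n ^ 2 / 9| ≤ e * n ^ 2)
    (T : Finset V) (hT : (T.card : ℝ) ≤ e * n)
    (hdeg : ∀ v ∉ T, |((N v).card : ℝ) - n / 3| ≤ e * n) :
    ∃ C : Fin 3 → Finset V, (∀ i j, i ≠ j → Disjoint (C i) (C j)) ∧ (∀ v, ∃ i, v ∈ C i) ∧
      ∀ i, ∀ x ∈ C i, ∀ y ∈ C i, y ∈ N x := by
  have hn2 : 0 < n ^ 2 := by positivity
  have hen : 0 < e * n := by subst he; positivity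
  have huniv : ((Finset.univ : Finset V).card : ℝ) = n := by rw [hnV, Finset.card_univ]
  have hle (S : Finset V) : (S.card : ℝ) ≤ n := by
    rw [hnV]
    exact_mod_cast S.card_le_univ
  have hex (S : Finset V) (hS : (S.card : ℝ) < n) : ∃ v, v ∉ S := by
    by_contra! hall
    rw [Finset.eq_univ_iff_forall.2 hall, huniv] at hS
    exact lt_irrefl _ hS
  have hun (S S' : Finset V) : ((S ∪ S').card : ℝ) ≤ S.card + S'.card := by
    exact_mod_cast Finset.card_union_le S S'
  obtain ⟨a, ha⟩ := hex T (by subst he; linarith)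
  have hda := abs_le.1 (hdeg a ha)
  obtain ⟨b, hb⟩ := hex (T ∪ N a) (by
    have := hun T (N a)
    subst he
    linarith [hda.2])
  simp only [Finset.mem_union, not_or] at hb
  have hdb := abs_le.1 (hdeg b hb.1)
  obtain ⟨c, hc⟩ := hex (T ∪ N a ∪ N b) (by
    have := hun T (N a)
    have := hun (T ∪ N a) (N b)
    subst he
    linarith [hda.2, hdb.2])
  simp only [Finset.mem_union, not_or] at hc
  have hdc := abs_le.1 (hdeg c hc.1.1)
  let B : Fin 3 → Finset V := ![N a, N b, N c]
  have hcover (x : V) : x ∈ N a ∨ x ∈ N b ∨ x ∈ N c := by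
    rcases hfour a b c x with h | h | h | h | h | h
    exacts [absurd h hb.2, absurd h hc.1.2, Or.inl h, absurd h hc.2, Or.inr (Or.inl h),
      Or.inr (Or.inr h)]
  have hpair (P Q R : Finset V) (hcov : ∀ x, x ∈ P ∨ x ∈ Q ∨ x ∈ R)
      (hP : (P.card : ℝ) ≤ n / 3 + e * n) (hQ : (Q.card : ℝ) ≤ n / 3 + e * n)
      (hR : (R.card : ℝ) ≤ n / 3 + e * n) : ((P ∩ Q).card : ℝ) ≤ 3 * e * n := by
    have h1 : (P ∪ Q) ∪ R = Finset.univ := by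
      ext x
      have := hcov x
      simp only [Finset.mem_union, Finset.mem_univ, iff_true]
      tauto
    have h2 := hun (P ∪ Q) R
    rw [h1, huniv] at h2
    have h3 : ((P ∪ Q).card : ℝ) + (P ∩ Q).card = P.card + Q.card := by
      exact_mod_cast Finset.card_union_add_card_inter P Q
    linarith
  have hinter (i j : Fin 3) (hij : i ≠ j) : ((B i ∩ B j).card : ℝ) ≤ 3 * e * n := by
    have ha' : ((N a).card : ℝ) ≤ n / 3 + e * n := by linarith [hda.2]
    have hb' : ((N b).card : ℝ) ≤ n / 3 + e * n := by linarith [hdb.2]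
    have hc' : ((N c).card : ℝ) ≤ n / 3 + e * n := by linarith [hdc.2]
    have hab := hpair (N a) (N b) (N c) hcover ha' hb' hc'
    have hac := hpair (N a) (N c) (N b) (fun x => by have := hcover x; tauto) ha' hc' hb'
    have hbc := hpair (N b) (N c) (N a) (fun x => by have := hcover x; tauto) hb' hc' ha'
    have hba := hab
    have hca := hac
    have hcb := hbc
    rw [Finset.inter_comm] at hba hca hcb
    fin_cases i <;> fin_cases j <;> first | exact absurd rfl hij | assumption
  have hB (j : Fin 3) : ∃ v ∉ T, B j = N v := by
    fin_cases j
    exacts [⟨a, ha, rfl⟩, ⟨b, hb.1, rfl⟩, ⟨c, hc.1.1, rfl⟩]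
  have hsq (v : V) (hv : v ∉ T) : ((N v).card : ℝ) ^ 2 ≤ (1 / 9 + 2 / 3 * e + e ^ 2) * n ^ 2 := by
    have h1 := abs_le.1 (hdeg v hv)
    have h2 : ((N v).card : ℝ) ^ 2 ≤ (n / 3 + e * n) ^ 2 :=
      pow_le_pow_left₀ (by positivity) (by linarith [h1.2]) 2
    linarith
  have hmiss (j : Fin 3) : ∑ x ∈ B j, ((B j \ N x).card : ℝ) ≤ 2 * e * n ^ 2 := by
    obtain ⟨v, hv, hBv⟩ := hB j
    rw [hBv]
    -- Missing pairs in `N v` number |N v|² minus the closed triangle count, and both are close to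
    -- n² / 9.
    have h1 : ∑ x ∈ N v, ((N v \ N x).card : ℝ) + ∑ x ∈ N v, ((N v ∩ N x).card : ℝ)
        = ((N v).card : ℝ) ^ 2 := by
      rw [← Finset.sum_add_distrib, sq, ← nsmul_eq_mul, ← Finset.sum_const]
      refine Finset.sum_congr rfl fun x _ => ?_
      exact_mod_cast Finset.card_sdiff_add_card_inter (N v) (N x)
    have h2 := (abs_le.1 (htri v)).1
    have h3 := hsq v hv
    subst he
    linarith
  have hout (v : V) (hv : v ∉ T) : ∑ x ∈ N v, ((N x \ N v).card : ℝ) ≤ 3 * e * n ^ 2 := by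
    have h1 : ∑ x ∈ N v, ((N x \ N v).card : ℝ) + ∑ x ∈ N v, ((N v ∩ N x).card : ℝ)
        = ∑ x ∈ N v, ((N x).card : ℝ) := by
      rw [← Finset.sum_add_distrib]
      refine Finset.sum_congr rfl fun x _ => ?_
      rw [Finset.inter_comm]
      exact_mod_cast Finset.card_sdiff_add_card_inter (N x) (N v)
    -- The vertices of `T` have uncontrolled degree, but contribute at most e n · n.
    have h2 : ∑ x ∈ N v, ((N x).card : ℝ) ≤ (N v).card * (n / 3 + e * n) + e * n * n := by
      have h3 : ∑ x ∈ N v, ((N x).card : ℝ)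
          ≤ ∑ x ∈ N v, ((n / 3 + e * n) + if x ∈ T then n else 0) := by
        refine Finset.sum_le_sum fun x _ => ?_
        split_ifs with hx
        · have := hle (N x)
          linarith
        · have := (abs_le.1 (hdeg x hx)).2
          linarith
      refine h3.trans ?_
      rw [Finset.sum_add_distrib, Finset.sum_const, nsmul_eq_mul, ← Finset.sum_filter,
        Finset.sum_const, nsmul_eq_mul]
      have h4 : (((N v).filter (· ∈ T)).card : ℝ) ≤ T.card := by
        exact_mod_cast Finset.card_le_card fun x hx => (Finset.mem_filter.1 hx).2
      have h5 := mul_le_mul_of_nonneg_right (h4.trans hT) hn.le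
      linarith
    have h3 := (abs_le.1 (hdeg v hv)).2
    have h4 : ((N v).card : ℝ) * (n / 3 + e * n) ≤ (n / 3 + e * n) * (n / 3 + e * n) :=
      mul_le_mul_of_nonneg_right (by linarith) (by linarith)
    have h5 := (abs_le.1 (htri v)).1
    subst he
    nlinarith
  have hcross (i j : Fin 3) (hij : i ≠ j) :
      ∑ x ∈ B i, ((N x ∩ B j).card : ℝ) ≤ 6 * e * n ^ 2 := by
    have hij' := hinter i j hij
    obtain ⟨v, hv, hBv⟩ := hB i
    have h1 : ∑ x ∈ B i, ((N x ∩ B j).card : ℝ)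
        ≤ ∑ x ∈ B i, (((N x \ B i).card : ℝ) + (B i ∩ B j).card) := by
      refine Finset.sum_le_sum fun x _ => ?_
      have : (N x ∩ B j).card ≤ ((N x \ B i) ∪ (B i ∩ B j)).card := by
        refine Finset.card_le_card fun y hy => ?_
        simp only [Finset.mem_union, Finset.mem_sdiff, Finset.mem_inter] at hy ⊢
        tauto
      exact_mod_cast this.trans (Finset.card_union_le _ _)
    rw [Finset.sum_add_distrib, Finset.sum_const, nsmul_eq_mul] at h1
    have h2 : ((B i).card : ℝ) * (B i ∩ B j).card ≤ n * (3 * e * n) :=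
      mul_le_mul (hle _) hij' (by positivity) hn.le
    have h3 := hout v hv
    rw [← hBv] at h3
    linarith
  refine exists_partition_of_near_cliques N hfour hn he B ?_ hinter hmiss hcross ?_
  · intro j
    obtain ⟨v, hv, hBv⟩ := hB j
    rw [hBv]
    linarith [(abs_le.1 (hdeg v hv)).1]
  · intro v
    linarith [(abs_le.1 (htri v)).2]

end Stability

/-! ### Passing from `Fin n` to arbitrary vertex types. -/

section Transfer

variable {V : Type*}

theorem IndepSetFree.comap {W : Type*} {G : SimpleGraph V} (h : G.IndepSetFree 4) (e : W ≃ V) :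
    (G.comap e).IndepSetFree 4 := by
  rw [indepSetFree_four_iff] at h ⊢
  intro a b c d
  simpa only [comap_adj, e.injective.eq_iff] using h (e a) (e b) (e c) (e d)

theorem numCliques_three_comap {W : Type*} [Fintype V] [Fintype W] (G : SimpleGraph V)
    (e : W ≃ V) : (G.comap e).numCliques 3 = G.numCliques 3 := by
  have hc (a b : W) : (G.comap e).closedAdj a b = G.closedAdj (e a) (e b) := by
    unfold closedAdj
    by_cases h : e a = e b ∨ G.Adj (e a) (e b)
    · rw [if_pos h, if_pos (show a = b ∨ (G.comap e).Adj a b from h.imp_left fun h => e.injective h)]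
    · rw [if_neg h, if_neg fun hn : a = b ∨ (G.comap e).Adj a b => h (hn.imp_left fun h => congrArg e h)]
  have hk (a : W) : (G.comap e).closedDeg a = G.closedDeg (e a) := by
    simp only [closedDeg, hc]
    exact Equiv.sum_comp e fun x => G.closedAdj (e a) x
  have ht (a : W) : (G.comap e).closedTri a = G.closedTri (e a) := by
    simp only [closedTri, hc]
    have h (x : V) := Equiv.sum_comp e
      fun y => G.closedAdj (e a) x * G.closedAdj (e a) y * G.closedAdj x y
    simp only [h]
    exact Equiv.sum_comp e
      fun x => ∑ y, G.closedAdj (e a) x * G.closedAdj (e a) y * G.closedAdj x y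
  have h1 := (G.comap e).six_mul_numCliques
  have h2 := G.six_mul_numCliques
  simp only [hk, ht, Equiv.sum_comp e, Fintype.card_congr e] at h1
  omega

theorem minCliques_le [Fintype V] {G : SimpleGraph V} (h : G.IndepSetFree 4) :
    minCliques (Fintype.card V) 3 4 ≤ G.numCliques 3 :=
  (isLeast_minCliques _ 3 4 (by norm_num)).2
    ⟨G.comap (Fintype.equivFin V).symm, h.comap _, numCliques_three_comap G _⟩

theorem exists_isCliqueExtremal (n : ℕ) : ∃ G : SimpleGraph (Fin n), G.IsCliqueExtremal 3 4 := by
  obtain ⟨G, hG, h⟩ := (isLeast_minCliques n 3 4 (by norm_num)).1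
  exact ⟨G, hG, by rw [h, Fintype.card_fin]⟩

end Transfer

/-! ### Minimisers are covered by three cliques. -/

section Extremal

variable [Fintype V] {G : SimpleGraph V}

theorem closedDeg_eq_card [DecidableEq V] [DecidableRel G.Adj] (v : V) :
    G.closedDeg v = (Finset.univ.filter fun x => v = x ∨ G.Adj v x).card := by
  rw [Finset.card_filter]
  push_cast
  refine Finset.sum_congr rfl fun x _ => ?_
  unfold closedAdj
  congr

theorem closedTri_eq_sum_card [DecidableEq V] [DecidableRel G.Adj] (v : V) :
    G.closedTri v = ∑ x ∈ Finset.univ.filter (fun x => v = x ∨ G.Adj v x),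
      (((Finset.univ.filter fun y => v = y ∨ G.Adj v y) ∩
        (Finset.univ.filter fun y => x = y ∨ G.Adj x y)).card : ℤ) := by
  rw [Finset.sum_filter]
  refine Finset.sum_congr rfl fun x _ => ?_
  rw [← Finset.filter_and, Finset.card_filter]
  by_cases hx : v = x ∨ G.Adj v x
  · rw [if_pos hx]
    push_cast
    refine Finset.sum_congr rfl fun y _ => ?_
    unfold closedAdj
    by_cases h1 : v = y ∨ G.Adj v y <;> by_cases h2 : x = y ∨ G.Adj x y <;> simp [hx, h1, h2]
  · rw [if_neg hx]
    refine Finset.sum_eq_zero fun y _ => ?_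
    have : G.closedAdj v x = 0 := if_neg hx
    simp [this]

/-- In an almost optimal graph with minimum number of triangles all vertices lie in the same
number of triangles up to a linear error, and the degrees are close to `n / 3` in the mean. -/
theorem IndepSetFree.bounds (h : G.IndepSetFree 4)
    (hmin : ∀ G' : SimpleGraph V, G'.IndepSetFree 4 → G.numCliques 3 ≤ G'.numCliques 3)
    (hub : 54 * G.numCliques 3 ≤ Fintype.card V ^ 3) (hV : 0 < Fintype.card V) :
    (∀ v, |9 * G.closedTri v - (Fintype.card V : ℤ) ^ 2| ≤ 54 * (Fintype.card V : ℤ)) ∧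
      ∑ v, ((Fintype.card V : ℤ) - 3 * G.closedDeg v) ^ 2 ≤ 351 * (Fintype.card V : ℤ) ^ 2 := by
  have hclone := closedTri_le_of_forall_numCliques_le h hmin
  have hkey := h.sum_sq_le
  have hcount := G.six_mul_numCliques
  have hub' : 54 * (G.numCliques 3 : ℤ) ≤ (Fintype.card V : ℤ) ^ 3 := by exact_mod_cast hub
  have hcard : ∑ _v : V, (1 : ℤ) = Fintype.card V := by simp
  have hne : (Finset.univ : Finset V).Nonempty := by
    rwa [← Finset.card_pos, Finset.card_univ]
  have hk := G.closedDeg_le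
  have hk0 := G.closedDeg_nonneg
  set n : ℤ := (Fintype.card V : ℤ) with hn
  have hn0 : 0 < n := by rw [hn]; exact_mod_cast hV
  have hconst (c : ℤ) : ∑ _v : V, c = n * c := by
    rw [Finset.sum_const, Finset.card_univ, nsmul_eq_mul]
  have hks : ∑ v, G.closedDeg v ≤ n * n := by
    rw [← hconst]
    exact Finset.sum_le_sum fun v _ => hk v
  -- By `hub` the mean of 9t(v) is at most n² + 27n, where 27n bounds the contribution of degenerate
  -- triples.
  obtain ⟨u, -, hu⟩ : ∃ u ∈ (Finset.univ : Finset V), 9 * G.closedTri u ≤ n ^ 2 + 27 * n := by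
    refine Finset.exists_le_of_sum_le hne ?_
    rw [← Finset.mul_sum, hconst]
    nlinarith
  have hupper (v : V) : 9 * G.closedTri v ≤ n ^ 2 + 54 * n := by linarith [hclone u v]
  -- If this failed at one `w`, cloning would put every 9t(v) below n². As 13n - 12d(v) ≥ n > 0, the
  -- right side of the flag inequality would be negative.
  have hlower (w : V) : n ^ 2 - 27 * n ≤ 9 * G.closedTri w := by
    by_contra! hw
    have hneg : ∑ v, (9 * G.closedTri v - n ^ 2) * (13 * n - 12 * G.closedDeg v) < 0 := by
      refine Finset.sum_neg (fun v _ => ?_) hne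
      refine mul_neg_of_neg_of_pos ?_ ?_
      · linarith [hclone w v]
      · linarith [hk v]
    have hnn : 0 ≤ 2 * n * ∑ v, (n - 3 * G.closedDeg v) ^ 2 :=
      mul_nonneg (by positivity) (Finset.sum_nonneg fun v _ => sq_nonneg _)
    linarith
  refine ⟨fun v => abs_le.2 ⟨by linarith [hlower v], by linarith [hupper v]⟩, ?_⟩
  have hsum : ∑ v, (9 * G.closedTri v - n ^ 2) * (13 * n - 12 * G.closedDeg v)
      ≤ n * (54 * n * (13 * n)) := by
    rw [← hconst]
    refine Finset.sum_le_sum fun v _ => ?_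
    have h1 := hupper v
    have h2 := hk v
    have h3 := hk0 v
    calc _ ≤ 54 * n * (13 * n - 12 * G.closedDeg v) :=
          mul_le_mul_of_nonneg_right (by linarith) (by linarith)
      _ ≤ _ := mul_le_mul_of_nonneg_left (by linarith) (by linarith)
  have h2n : 0 < 2 * n := by linarith
  refine le_of_mul_le_mul_left (hkey.trans (hsum.trans_eq ?_)) h2n
  ring

theorem exists_clique_partition (h : G.IndepSetFree 4)
    (hmin : ∀ G' : SimpleGraph V, G'.IndepSetFree 4 → G.numCliques 3 ≤ G'.numCliques 3)
    (hub : 54 * G.numCliques 3 ≤ Fintype.card V ^ 3) (hV : 10 ^ 32 ≤ Fintype.card V) :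
    ∃ C : Fin 3 → Finset V, (∀ i j, i ≠ j → Disjoint (C i) (C j)) ∧ (∀ v, ∃ i, v ∈ C i) ∧
      ∀ i, G.IsClique (C i : Set V) := by
  classical
  obtain ⟨htri, hdeg⟩ := h.bounds hmin hub (lt_of_lt_of_le (by norm_num) hV)
  obtain ⟨n, hn⟩ : ∃ n : ℝ, n = Fintype.card V := ⟨_, rfl⟩
  have hnbig : (10 : ℝ) ^ 32 ≤ n := by rw [hn]; exact_mod_cast hV
  have hn0 : 0 < n := lt_of_lt_of_le (by norm_num) hnbig
  obtain ⟨e, he⟩ : ∃ e : ℝ, e = 1 / 10 ^ 10 := ⟨_, rfl⟩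
  let N : V → Finset V := fun v => Finset.univ.filter fun x => v = x ∨ G.Adj v x
  have hN (x y : V) : y ∈ N x ↔ (x = y ∨ G.Adj x y) := by simp [N]
  have hk (v : V) : ((N v).card : ℝ) = G.closedDeg v := by
    rw [closedDeg_eq_card]
    push_cast
    rfl
  have ht (v : V) : ∑ x ∈ N v, ((N v ∩ N x).card : ℝ) = G.closedTri v := by
    rw [closedTri_eq_sum_card]
    push_cast
    rfl
  let T : Finset V := Finset.univ.filter fun v => e * n < |((N v).card : ℝ) - n / 3|
  have hT : (T.card : ℝ) ≤ e * n := by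
    have h1 : ∑ v, (n - 3 * (N v).card) ^ 2 ≤ 351 * n ^ 2 := by
      simp only [hk, hn]
      exact_mod_cast hdeg
    have h2 : ∑ v ∈ T, (3 * (e * n)) ^ 2 ≤ ∑ v ∈ T, (n - 3 * (N v).card) ^ 2 := by
      refine Finset.sum_le_sum fun v hv => ?_
      have hv' : e * n < |((N v).card : ℝ) - n / 3| := (Finset.mem_filter.1 hv).2
      have h0 : 0 ≤ e * n := by subst he; positivity
      have h3 := pow_le_pow_left₀ h0 hv'.le 2
      rw [sq_abs] at h3
      nlinarith
    have h3 : ∑ v ∈ T, (n - 3 * ((N v).card : ℝ)) ^ 2 ≤ ∑ v, (n - 3 * ((N v).card : ℝ)) ^ 2 :=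
      Finset.sum_le_sum_of_subset_of_nonneg (Finset.subset_univ _) fun _ _ _ => sq_nonneg _
    rw [Finset.sum_const, nsmul_eq_mul] at h2
    -- Chebyshev's inequality: |T| ≤ 39 · 10 ^ 20, which is below e n = n / 10 ^ 10 once n ≥ 10 ^
    -- 32. This fixes the size of n₀.
    have h4 : (T.card : ℝ) * (9 * e ^ 2) ≤ 351 := by
      have hn2 : 0 < n ^ 2 := by positivity
      refine le_of_mul_le_mul_right ?_ hn2
      linarith
    subst he
    norm_num at h4 hnbig ⊢
    linarith
  have hpart := exists_partition_of_typical N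
    (fun a b c d => by simpa only [hN] using h.exists_closedAdj a b c d) hn0 hn he
    (fun v => by
      rw [ht]
      have h1 : |9 * (G.closedTri v : ℝ) - n ^ 2| ≤ 54 * n := by
        rw [hn]
        exact_mod_cast htri v
      rw [abs_le] at h1 ⊢
      subst he
      constructor <;> nlinarith) T hT
    (fun v hv => by
      simp only [T, Finset.mem_filter, Finset.mem_univ, true_and, not_lt] at hv
      exact hv)
  obtain ⟨C, hd, hc, hcl⟩ := hpart
  refine ⟨C, hd, hc, fun i x hx y hy hxy => ?_⟩
  exact ((hN x y).1 (hcl i x hx y hy)).resolve_left hxy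

end Extremal

/-! ### Convexity of the number of triangles in three cliques. -/

theorem six_mul_choose_three (a : ℕ) : 6 * (a.choose 3 : ℤ) = a * (a - 1) * (a - 2) := by
  have h2 (a : ℕ) : 2 * (a.choose 2 : ℤ) = a * (a - 1) := by
    induction a with
    | zero => simp
    | succ a ih =>
      rw [Nat.choose_succ_succ' a 1]
      push_cast [Nat.choose_one_right]
      linarith
  induction a with
  | zero => simp
  | succ a ih =>
    rw [Nat.choose_succ_succ' a 2]
    push_cast
    linarith [h2 a]

/-- The secant inequality for `a ↦ a.choose 3`, with the exact error term. -/
theorem six_mul_choose_three_eq (a q : ℕ) :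
    6 * (a.choose 3 : ℤ) = q * (q - 1) * (q - 2) + 3 * (a - q) * (q * (q - 1))
      + (a - q) * (a - q - 1) * (2 * q + a - 2) := by
  rw [six_mul_choose_three]
  ring

/-- No integer lies strictly between `q` and `q + 1`, so the first two factors never have opposite
signs. -/
theorem secant_error_nonneg (a q : ℕ) (hq : 1 ≤ q) :
    0 ≤ ((a : ℤ) - q) * (a - q - 1) * (2 * q + a - 2) := by
  refine mul_nonneg ?_ (by omega)
  rcases le_or_gt a q with h | h
  · exact mul_nonneg_of_nonpos_of_nonpos (by omega) (by omega)
  · exact mul_nonneg (by omega) (by omega)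

theorem secant_error_eq_zero_iff (a q : ℕ) (hq : 2 ≤ q) :
    ((a : ℤ) - q) * (a - q - 1) * (2 * q + a - 2) = 0 ↔ a = q ∨ a = q + 1 := by
  rw [mul_eq_zero, mul_eq_zero]
  omega

/-- The number of triangles in three disjoint cliques on `n` vertices with balanced sizes. -/
def threeCliqueBound (n : ℕ) : ℕ := (n / 3).choose 3 + ((n + 1) / 3).choose 3 + ((n + 2) / 3).choose 3

theorem six_mul_threeCliqueBound (n : ℕ) (hn : 6 ≤ n) :
    6 * (threeCliqueBound n : ℤ) = 3 * ((n / 3 : ℕ) * ((n / 3 : ℕ) - 1) * ((n / 3 : ℕ) - 2))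
      + 3 * (n - 3 * (n / 3 : ℕ)) * ((n / 3 : ℕ) * ((n / 3 : ℕ) - 1)) := by
  have h1 := six_mul_choose_three_eq (n / 3) (n / 3)
  have h2 := six_mul_choose_three_eq ((n + 1) / 3) (n / 3)
  have h3 := six_mul_choose_three_eq ((n + 2) / 3) (n / 3)
  rw [(secant_error_eq_zero_iff _ _ (by omega)).2 (by omega)] at h1 h2 h3
  have h4 : (n : ℤ) = (n / 3 : ℕ) + ((n + 1) / 3 : ℕ) + ((n + 2) / 3 : ℕ) := by omega
  have h5 : (n : ℤ) - 3 * (n / 3 : ℕ)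
    = (((n + 1) / 3 : ℕ) - (n / 3 : ℕ)) + (((n + 2) / 3 : ℕ) - (n / 3 : ℕ)) := by omega
  rw [h5, threeCliqueBound]
  push_cast only [Nat.cast_add] at *
  linarith

/-- The linear part of the secant expansion at `n / 3` depends only on the total `n`, so only the
error terms distinguish `a` from the balanced sizes. -/
theorem sum_choose_three_eq (n : ℕ) (hn : 6 ≤ n) (a : Fin 3 → ℕ) (ha : ∑ i, a i = n) :
    6 * ∑ i, ((a i).choose 3 : ℤ) = 6 * threeCliqueBound n
      + ∑ i, ((a i : ℤ) - (n / 3 : ℕ)) * (a i - (n / 3 : ℕ) - 1) * (2 * (n / 3 : ℕ) + a i - 2) := by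
  rw [six_mul_threeCliqueBound n hn, Finset.mul_sum, ← ha]
  simp only [six_mul_choose_three_eq _ ((∑ i, a i) / 3), Fin.sum_univ_three]
  push_cast only [Nat.cast_add]
  ring

theorem threeCliqueBound_le (n : ℕ) (hn : 6 ≤ n) (a : Fin 3 → ℕ) (ha : ∑ i, a i = n) :
    threeCliqueBound n ≤ ∑ i, (a i).choose 3 := by
  have h := sum_choose_three_eq n hn a ha
  have h1 := Finset.sum_nonneg fun i (_ : i ∈ Finset.univ) =>
    secant_error_nonneg (a i) (n / 3) (by omega)
  zify
  linarith

theorem sum_choose_three_eq_iff (n : ℕ) (hn : 6 ≤ n) (a : Fin 3 → ℕ) (ha : ∑ i, a i = n) :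
    ∑ i, (a i).choose 3 = threeCliqueBound n ↔ ∀ i j, a i ≤ a j + 1 := by
  have h := sum_choose_three_eq n hn a ha
  have h1 := Finset.sum_eq_zero_iff_of_nonneg fun i (_ : i ∈ Finset.univ) =>
    secant_error_nonneg (a i) (n / 3) (by omega)
  have h2 : ∑ i, (a i).choose 3 = threeCliqueBound n ↔ ∀ i, a i = n / 3 ∨ a i = n / 3 + 1 := by
    simp only [← secant_error_eq_zero_iff _ (n / 3) (show 2 ≤ n / 3 by omega)]
    simp only [Finset.mem_univ, true_imp_iff] at h1
    rw [← h1]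
    rw [← @Nat.cast_inj ℤ, Nat.cast_sum]
    constructor <;> intro <;> linarith
  rw [h2]
  simp only [Fin.sum_univ_three] at ha
  constructor
  · intro h i j
    have hi := h i
    have hj := h j
    omega
  · intro h
    have h01 := h 0 1
    have h02 := h 0 2
    have h10 := h 1 0
    have h12 := h 1 2
    have h20 := h 2 0
    have h21 := h 2 1
    intro i
    match i with
    | 0 => omega
    | 1 => omega
    | 2 => omega

theorem threeCliqueBound_le_cube (n : ℕ) (hn : 6 ≤ n) : 54 * threeCliqueBound n ≤ n ^ 3 := by
  have h := six_mul_threeCliqueBound n hn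
  have h3 : n = 3 * (n / 3) + n % 3 := by omega
  have h4 : n % 3 < 3 := Nat.mod_lt _ (by norm_num)
  have h5 : 2 ≤ n / 3 := by omega
  generalize n / 3 = q at *
  generalize n % 3 = r at *
  subst h3
  zify
  push_cast at h
  have hq : (2 : ℤ) ≤ q := by exact_mod_cast h5
  interval_cases r <;> push_cast at h ⊢ <;> nlinarith [sq_nonneg (q : ℤ)]

/-! ### Clique partitions and the extremal structure. -/

section Partition

variable {V : Type*} {G : SimpleGraph V} {C : Fin 3 → Finset V}

theorem indepSetFree_of_clique_cover (hc : ∀ v, ∃ i, v ∈ C i)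
    (hcl : ∀ i, G.IsClique (C i : Set V)) : G.IndepSetFree 4 := by
  rw [indepSetFree_four_iff]
  intro a b c d
  obtain ⟨i, hi⟩ := hc a
  obtain ⟨j, hj⟩ := hc b
  obtain ⟨k, hk⟩ := hc c
  obtain ⟨l, hl⟩ := hc d
  have key {m m' : Fin 3} {x y : V} (hx : x ∈ C m) (hy : y ∈ C m') (h : m = m') :
      x = y ∨ G.Adj x y := by
    subst h
    exact or_iff_not_imp_left.2 fun hxy => hcl m hx hy hxy
  have : i = j ∨ i = k ∨ i = l ∨ j = k ∨ j = l ∨ k = l := by omega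
  exact this.imp (key hi hj) <| Or.imp (key hi hk) <| Or.imp (key hi hl) <|
    Or.imp (key hj hk) <| Or.imp (key hj hl) (key hk hl)

/-- With its converse below, this recasts the matching and transversal conditions as a statement
about triangles, the form in which equality of counts delivers them. -/
theorem IsCliqueMatchingPartition.exists_subset (h : G.IsCliqueMatchingPartition C)
    (s : Finset V) (hs : G.IsNClique 3 s) : ∃ i, s ⊆ C i := by
  classical
  rw [is3Clique_iff] at hs
  obtain ⟨a, b, c, hab, hac, hbc, rfl⟩ := hs
  obtain ⟨i, hi⟩ := h.cover a
  obtain ⟨j, hj⟩ := h.cover b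
  obtain ⟨k, hk⟩ := h.cover c
  -- a vertex with two neighbours in a part lies in that part
  have key {m m' : Fin 3} {x y z : V} (hx : x ∈ C m) (hy : y ∈ C m) (hz : z ∈ C m')
      (hxy : x ≠ y) (hzx : G.Adj z x) (hzy : G.Adj z y) : m = m' := by
    by_contra hm
    exact hxy (h.matching m' m (Ne.symm hm) z hz x hx y hy hzx hzy)
  by_cases hij : i = j
  · subst hij
    have := key hi hj hk hab.ne hac.symm hbc.symm
    subst this
    exact ⟨i, by simp [Finset.insert_subset_iff, hi, hj, hk]⟩
  by_cases hik : i = k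
  · subst hik
    exact absurd (key hi hk hj hac.ne hab.symm hbc) hij
  by_cases hjk : j = k
  · subst hjk
    exact absurd (key hj hk hi hbc.ne hab hac).symm hij
  exfalso
  have hT := h.no_transversal
  have : ∀ i j k : Fin 3, i ≠ j → i ≠ k → j ≠ k →
      (i = 0 ∧ j = 1 ∧ k = 2) ∨ (i = 0 ∧ j = 2 ∧ k = 1) ∨ (i = 1 ∧ j = 0 ∧ k = 2) ∨
      (i = 1 ∧ j = 2 ∧ k = 0) ∨ (i = 2 ∧ j = 0 ∧ k = 1) ∨ (i = 2 ∧ j = 1 ∧ k = 0) := by decide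
  rcases this i j k hij hik hjk with ⟨rfl, rfl, rfl⟩ | ⟨rfl, rfl, rfl⟩ | ⟨rfl, rfl, rfl⟩ |
    ⟨rfl, rfl, rfl⟩ | ⟨rfl, rfl, rfl⟩ | ⟨rfl, rfl, rfl⟩
  · exact hT a hi b hj c hk ⟨hab, hbc, hac⟩
  · exact hT a hi c hk b hj ⟨hac, hbc.symm, hab⟩
  · exact hT b hj a hi c hk ⟨hab.symm, hac, hbc⟩
  · exact hT c hk a hi b hj ⟨hac.symm, hab, hbc.symm⟩
  · exact hT b hj c hk a hi ⟨hbc, hac.symm, hab.symm⟩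
  · exact hT c hk b hj a hi ⟨hbc.symm, hab.symm, hac.symm⟩

theorem isCliqueMatchingPartition_of_forall_exists_subset
    (hd : ∀ i j, i ≠ j → Disjoint (C i) (C j)) (hc : ∀ v, ∃ i, v ∈ C i)
    (hcl : ∀ i, G.IsClique (C i : Set V)) (hb : ∀ i j, (C i).card ≤ (C j).card + 1)
    (hs : ∀ s : Finset V, G.IsNClique 3 s → ∃ i, s ⊆ C i) : G.IsCliqueMatchingPartition C := by
  classical
  have huniq {x : V} {i j : Fin 3} (hi : x ∈ C i) (hj : x ∈ C j) : i = j := by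
    by_contra hij
    exact Finset.disjoint_left.1 (hd i j hij) hi hj
  refine ⟨hd, hc, hcl, hb, ?_, ?_⟩
  · intro i j hij v hv w hw w' hw' hvw hvw'
    by_contra hne
    obtain ⟨m, hm⟩ := hs {v, w, w'} (is3Clique_triple_iff.2 ⟨hvw, hvw', hcl j hw hw' hne⟩)
    exact hij ((huniq hv (hm (by simp))).trans (huniq hw (hm (by simp))).symm)
  · rintro x hx y hy z hz ⟨hxy, hyz, hxz⟩
    obtain ⟨m, hm⟩ := hs {x, y, z} (is3Clique_triple_iff.2 ⟨hxy, hxz, hyz⟩)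
    have h0 := huniq hx (hm (by simp))
    have h1 := huniq hy (hm (by simp))
    rw [← h1] at h0
    exact absurd h0 (by decide)

variable [Fintype V]

theorem sum_card_of_partition (hd : ∀ i j, i ≠ j → Disjoint (C i) (C j)) (hc : ∀ v, ∃ i, v ∈ C i) :
    ∑ i, (C i).card = Fintype.card V := by
  classical
  rw [← Finset.card_univ, ← Finset.card_biUnion fun i _ j _ hij => hd i j hij]
  congr 1
  ext v
  simpa using hc v

/-- The triangles inside the parts are all triangles iff there are only matchings between the
parts and no transversal triangles. -/
theorem sum_choose_le_numCliques (hd : ∀ i j, i ≠ j → Disjoint (C i) (C j))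
    (hcl : ∀ i, G.IsClique (C i : Set V)) :
    ∑ i, (C i).card.choose 3 ≤ G.numCliques 3 ∧
      (G.numCliques 3 = ∑ i, (C i).card.choose 3 ↔
        ∀ s : Finset V, G.IsNClique 3 s → ∃ i, s ⊆ C i) := by
  classical
  have hcard : (Finset.univ.biUnion fun i => (C i).powersetCard 3).card
      = ∑ i, (C i).card.choose 3 := by
    rw [Finset.card_biUnion]
    · simp only [Finset.card_powersetCard]
    · intro i _ j _ hij
      rw [Function.onFun, Finset.disjoint_left]
      intro s hs hs'
      rw [Finset.mem_powersetCard] at hs hs'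
      have : s = ∅ := Finset.subset_empty.1 ((Finset.subset_inter hs.1 hs'.1).trans
        (Finset.disjoint_iff_inter_eq_empty.1 (hd i j hij)).subset)
      simp [this] at hs
  have hsub : (Finset.univ.biUnion fun i => (C i).powersetCard 3) ⊆ G.cliqueFinset 3 := by
    intro s hs
    rw [Finset.mem_biUnion] at hs
    obtain ⟨i, -, hs⟩ := hs
    rw [Finset.mem_powersetCard] at hs
    rw [mem_cliqueFinset_iff]
    exact ⟨(hcl i).subset (Finset.coe_subset.2 hs.1), hs.2⟩
  rw [numCliques_eq_card, ← hcard]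
  refine ⟨Finset.card_le_card hsub, ?_, ?_⟩
  · intro h s hs
    rw [← mem_cliqueFinset_iff, ← Finset.eq_of_subset_of_card_le hsub h.le, Finset.mem_biUnion] at hs
    obtain ⟨i, -, hs⟩ := hs
    exact ⟨i, (Finset.mem_powersetCard.1 hs).1⟩
  · intro h
    refine congrArg Finset.card (Finset.Subset.antisymm (fun s hs => ?_) hsub)
    rw [mem_cliqueFinset_iff] at hs
    obtain ⟨i, hi⟩ := h s hs
    exact Finset.mem_biUnion.2 ⟨i, Finset.mem_univ _, Finset.mem_powersetCard.2 ⟨hi, hs.card_eq⟩⟩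

theorem IsCliqueMatchingPartition.numCliques_eq (h : G.IsCliqueMatchingPartition C)
    (hV : 6 ≤ Fintype.card V) : G.numCliques 3 = threeCliqueBound (Fintype.card V) := by
  rw [(sum_choose_le_numCliques h.disjoint h.isClique).2.2 h.exists_subset]
  exact (sum_choose_three_eq_iff _ hV _ (sum_card_of_partition h.disjoint h.cover)).2 h.card_le

theorem card_filter_mod_three (n : ℕ) (i : Fin 3) :
    (Finset.univ.filter fun v : Fin n => (v : ℕ) % 3 = i).card = (n + 2 - i) / 3 := by
  have h : ∀ n : ℕ, ((Finset.range n).filter fun v => v % 3 = (i : ℕ)).card = (n + 2 - i) / 3 := by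
    intro n
    induction n with
    | zero =>
      simp
      omega
    | succ n ih =>
      rw [Finset.range_add_one, Finset.filter_insert]
      split_ifs with hn
      · rw [Finset.card_insert_of_notMem (by simp), ih]
        omega
      · rw [ih]
        omega
  rw [← h n, Finset.card_filter, Finset.card_filter, Finset.sum_range]

theorem isCliqueMatchingPartition_turanGraph_compl (n : ℕ) :
    (turanGraph n 3)ᶜ.IsCliqueMatchingPartition
      fun i => Finset.univ.filter fun v : Fin n => (v : ℕ) % 3 = i := by
  have hadj (v w : Fin n) : (turanGraph n 3)ᶜ.Adj v w ↔ v ≠ w ∧ (v : ℕ) % 3 = w % 3 := by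
    rw [compl_adj, turanGraph_adj, not_not]
  refine ⟨?_, ?_, ?_, ?_, ?_, ?_⟩
  · intro i j hij
    rw [Finset.disjoint_left]
    intro v hv hv'
    simp only [Finset.mem_filter, Finset.mem_univ, true_and] at hv hv'
    omega
  · intro v
    exact ⟨⟨v % 3, Nat.mod_lt _ (by norm_num)⟩, by simp⟩
  · intro i v hv w hw hvw
    simp only [Finset.coe_filter, Finset.mem_univ, true_and, Set.mem_ofPred_eq] at hv hw
    exact (hadj v w).2 ⟨hvw, hv.trans hw.symm⟩
  · intro i j
    rw [card_filter_mod_three, card_filter_mod_three]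
    omega
  · intro i j hij v hv w hw w' _ hvw _
    simp only [Finset.mem_filter, Finset.mem_univ, true_and] at hv hw
    rw [hadj] at hvw
    omega
  · intro x hx y hy z _ h
    simp only [Finset.mem_filter, Finset.mem_univ, true_and] at hx hy
    have := ((hadj x y).1 h.1).2
    rw [hx, hy] at this
    exact absurd this (by decide)

theorem IsCliqueMatchingPartition.turanGraph_compl_isContained {n : ℕ}
    (h : G.IsCliqueMatchingPartition C) (hV : Fintype.card V = n) :
    (turanGraph n 3)ᶜ.IsContained G := by
  classical
  let D : Fin 3 → Finset (Fin n) := fun i => Finset.univ.filter fun v : Fin n => (v : ℕ) % 3 = i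
  have hsum := sum_card_of_partition h.disjoint h.cover
  obtain ⟨σ, hσ⟩ : ∃ σ : Equiv.Perm (Fin 3), ∀ i, (D i).card = (C (σ i)).card := by
    -- The residue classes 0, 1, 2 have non-increasing sizes, so the parts are sorted by decreasing
    -- size. Equal totals and differences of at most one then make the sizes agree.
    let σ := Tuple.sort fun i => -((C i).card : ℤ)
    have hmono : Monotone ((fun i => -((C i).card : ℤ)) ∘ σ) := Tuple.monotone_sort _
    have h01 := hmono (show (0 : Fin 3) ≤ 1 by decide)
    have h12 := hmono (show (1 : Fin 3) ≤ 2 by decide)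
    have h02 := h.card_le (σ 0) (σ 2)
    rw [← Equiv.sum_comp σ, Fin.sum_univ_three, hV] at hsum
    simp only [Function.comp_apply] at h01 h12
    refine ⟨σ, fun i => ?_⟩
    rw [card_filter_mod_three]
    match i with
    | 0 => simp only [Fin.val_zero]; omega
    | 1 => simp only [Fin.val_one]; omega
    | 2 => simp only [Fin.val_two]; omega
  let e (i : Fin 3) : D i ≃ C (σ i) := Finset.equivOfCardEq (hσ i)
  have hcls (v : Fin n) : v ∈ D ⟨v % 3, Nat.mod_lt _ (by norm_num)⟩ := by simp [D]
  let f (v : Fin n) : V := e _ ⟨v, hcls v⟩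
  have hf (i : Fin 3) (v : Fin n) (hv : v ∈ D i) : f v = e i ⟨v, hv⟩ := by
    have : i = ⟨v % 3, Nat.mod_lt _ (by norm_num)⟩ := by
      ext
      exact (Finset.mem_filter.1 hv).2.symm
    subst this
    rfl
  have hinj : Function.Injective f := by
    intro v w hvw
    have hi := hf _ v (hcls v)
    have hj := hf _ w (hcls w)
    have hij : (⟨v % 3, Nat.mod_lt _ (by norm_num)⟩ : Fin 3)
        = ⟨w % 3, Nat.mod_lt _ (by norm_num)⟩ := by
      by_contra hne
      refine Finset.disjoint_left.1 (h.disjoint _ _ (σ.injective.ne hne))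
        (e _ ⟨v, hcls v⟩).2 ?_
      rw [← hi, hvw, hj]
      exact (e _ ⟨w, hcls w⟩).2
    have hw : w ∈ D ⟨v % 3, Nat.mod_lt _ (by norm_num)⟩ := hij ▸ hcls w
    rw [hi, hf _ w hw] at hvw
    simpa using (e _).injective (Subtype.ext hvw)
  refine ⟨⟨⟨f, ?_⟩, hinj⟩⟩
  intro v w hvw
  rw [compl_adj, turanGraph_adj, not_not] at hvw
  have hw : w ∈ D ⟨v % 3, Nat.mod_lt _ (by norm_num)⟩ :=
    Finset.mem_filter.2 ⟨Finset.mem_univ _, hvw.2.symm⟩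
  have hne := hinj.ne hvw.1
  refine h.isClique _ (e _ ⟨v, hcls v⟩).2 ?_ hne
  rw [hf _ w hw]
  exact (e _ ⟨w, hw⟩).2

theorem minCliques_le_threeCliqueBound (n : ℕ) (hn : 6 ≤ n) :
    minCliques n 3 4 ≤ threeCliqueBound n := by
  have h := isCliqueMatchingPartition_turanGraph_compl n
  have h1 := h.numCliques_eq (by simpa using hn)
  have h2 := minCliques_le (indepSetFree_of_clique_cover h.cover h.isClique)
  rw [h1] at h2
  simpa using h2

/-- The balanced count is at most the number of triangles inside the parts, hence at most that in
`G`, which by minimality is at most the balanced count. Equality in the first step gives balance, in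
the second the matching structure. -/
theorem IsCliqueExtremal.exists_isCliqueMatchingPartition (h : G.IsCliqueExtremal 3 4)
    (hV : 10 ^ 32 ≤ Fintype.card V) : ∃ C : Fin 3 → Finset V, G.IsCliqueMatchingPartition C := by
  have hV' : 6 ≤ Fintype.card V := le_trans (by norm_num) hV
  have hle := minCliques_le_threeCliqueBound _ hV'
  rw [← h.2] at hle
  obtain ⟨C, hd, hc, hcl⟩ := exists_clique_partition h.1
    (fun G' hG' => h.2.trans_le (minCliques_le hG'))
    ((Nat.mul_le_mul_left _ hle).trans (threeCliqueBound_le_cube _ hV')) hV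
  have hsum := sum_card_of_partition hd hc
  have h1 := threeCliqueBound_le _ hV' _ hsum
  obtain ⟨h2, h3⟩ := sum_choose_le_numCliques hd hcl
  exact ⟨C, isCliqueMatchingPartition_of_forall_exists_subset hd hc hcl
    ((sum_choose_three_eq_iff _ hV' _ hsum).1 (by omega)) (h3.1 (by omega))⟩

theorem minCliques_eq_threeCliqueBound (n : ℕ) (hn : 10 ^ 32 ≤ n) :
    minCliques n 3 4 = threeCliqueBound n := by
  obtain ⟨G, hG⟩ := exists_isCliqueExtremal n
  obtain ⟨C, hC⟩ := hG.exists_isCliqueMatchingPartition (by simpa using hn)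
  have h := hG.2
  rw [hC.numCliques_eq (by simpa using le_trans (by norm_num) hn), Fintype.card_fin] at h
  exact h.symm

theorem IsCliqueMatchingPartition.isCliqueExtremal (h : G.IsCliqueMatchingPartition C)
    (hV : 10 ^ 32 ≤ Fintype.card V) : G.IsCliqueExtremal 3 4 :=
  ⟨indepSetFree_of_clique_cover h.cover h.isClique, by
    rw [h.numCliques_eq (le_trans (by norm_num) hV), minCliques_eq_threeCliqueBound _ hV]⟩

end Partition

/-! ### The asymptotic value. -/

theorem abs_threeCliqueBound_sub_le (n : ℕ) (hn : 6 ≤ n) :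
    |(threeCliqueBound n : ℝ) - 1 / 9 * n.choose 3| ≤ n ^ 2 := by
  have h := six_mul_threeCliqueBound n hn
  have hc := six_mul_choose_three n
  have h3 : n = 3 * (n / 3) + n % 3 := by omega
  have h4 : n % 3 < 3 := Nat.mod_lt _ (by norm_num)
  have h5 : 2 ≤ n / 3 := by omega
  generalize n / 3 = q at *
  generalize n % 3 = r at *
  generalize threeCliqueBound n = t at *
  generalize n.choose 3 = c at *
  subst h3
  have hq : (2 : ℝ) ≤ q := by exact_mod_cast h5
  have h' := congrArg (Int.cast : ℤ → ℝ) h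
  have hc' := congrArg (Int.cast : ℤ → ℝ) hc
  rw [abs_le]
  -- For each residue both quantities are cubic polynomials in `q` with the same leading term, so
  -- they differ by O(n²).
  interval_cases r <;> push_cast at h' hc' ⊢ <;> constructor <;> nlinarith [sq_nonneg (q : ℝ)]

theorem isEquivalent_threeCliqueBound :
    Asymptotics.IsEquivalent Filter.atTop (fun n : ℕ => (threeCliqueBound n : ℝ))
      (fun n : ℕ => (1 / 9 : ℝ) * (n.choose 3 : ℝ)) := by
  have h1 : (fun n : ℕ => (threeCliqueBound n : ℝ) - 1 / 9 * (n.choose 3 : ℝ))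
      =O[Filter.atTop] fun n : ℕ => (n : ℝ) ^ 2 := by
    refine Asymptotics.IsBigO.of_bound 1 ?_
    filter_upwards [Filter.eventually_ge_atTop 6] with n hn
    rw [one_mul, Real.norm_eq_abs, Real.norm_of_nonneg (by positivity)]
    exact abs_threeCliqueBound_sub_le n hn
  have h2 : (fun n : ℕ => (n : ℝ) ^ 2) =o[Filter.atTop] fun n : ℕ => (n : ℝ) ^ 3 :=
    (Asymptotics.isLittleO_pow_pow_atTop_of_lt (𝕜 := ℝ) (by norm_num : 2 < 3)).comp_tendsto
      tendsto_natCast_atTop_atTop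
  have h3 : (fun n : ℕ => (n : ℝ) ^ 3)
      =O[Filter.atTop] fun n : ℕ => (1 / 9 : ℝ) * (n.choose 3 : ℝ) := by
    refine Asymptotics.IsBigO.of_bound 216 ?_
    filter_upwards [Filter.eventually_ge_atTop 6] with n hn
    rw [Real.norm_of_nonneg (by positivity), Real.norm_of_nonneg (by positivity)]
    have h := congrArg (Int.cast : ℤ → ℝ) (six_mul_choose_three n)
    push_cast at h
    have hn' : (6 : ℝ) ≤ n := by exact_mod_cast hn
    nlinarith [mul_le_mul_of_nonneg_left hn' (sq_nonneg (n : ℝ))]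
  exact (h1.trans_isLittleO h2).trans_isBigO h3

end SimpleGraph
theorem theorem1p2 :
    (∃ n₀ : ℕ, ∀ n : ℕ, n₀ ≤ n →
      -- the exact value of `f(n,3,4)`
      SimpleGraph.minCliques n 3 4
          = (n / 3).choose 3 + ((n + 1) / 3).choose 3 + ((n + 2) / 3).choose 3 ∧
      -- the complement of the Turán graph is extremal
      (SimpleGraph.turanGraph n 3)ᶜ.IsCliqueExtremal 3 4 ∧
      ∀ (V : Type*) [Fintype V] (G : SimpleGraph V), Fintype.card V = n →
        -- every extremal graph contains the complement of the Turán graph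
        (G.IsCliqueExtremal 3 4 → (SimpleGraph.turanGraph n 3)ᶜ.IsContained G) ∧
        -- the structure of the extremal graphs
        (G.IsCliqueExtremal 3 4 ↔
          ∃ C : Fin 3 → Finset V, G.IsCliqueMatchingPartition C)) ∧
    -- the asymptotic value of `f(n,3,4)`
    Asymptotics.IsEquivalent Filter.atTop
      (fun n : ℕ => (SimpleGraph.minCliques n 3 4 : ℝ))
      (fun n : ℕ => (1 / 9 : ℝ) * (n.choose 3 : ℝ)) := by
  refine ⟨⟨10 ^ 32, fun n hn => ⟨SimpleGraph.minCliques_eq_threeCliqueBound n hn,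
    (SimpleGraph.isCliqueMatchingPartition_turanGraph_compl n).isCliqueExtremal
      (by rwa [Fintype.card_fin]), fun V _ G hV => ⟨fun hG => ?_, fun hG => ?_, fun hG => ?_⟩⟩⟩, ?_⟩
  · obtain ⟨C, hC⟩ := hG.exists_isCliqueMatchingPartition (hn.trans_eq hV.symm)
    exact hC.turanGraph_compl_isContained hV
  · exact hG.exists_isCliqueMatchingPartition (hn.trans_eq hV.symm)
  · obtain ⟨C, hC⟩ := hG
    exact hC.isCliqueExtremal (hn.trans_eq hV.symm)
  · refine SimpleGraph.isEquivalent_threeCliqueBound.congr_left ?_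
    filter_upwards [Filter.eventually_ge_atTop (10 ^ 32)] with n hn
    rw [SimpleGraph.minCliques_eq_threeCliqueBound n hn]
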